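/- Let $n\ge 3$ and consider the family of linear ordinary differential equations $$y^{(n)}+a_{n-3}(x)\,y^{(n-3)}+a_{n-4}(x)\,y^{(n-4)}+\dots+a_0(x)\,y=0 ,\qquad (*)$$ with arbitrary smooth real coefficients $a_0,\dots,a_{n-3}$. Let $G$ be the equivalence group of this family (the local point transformations $(x,y)\mapsto(\bar x,\bar y)$ that map every equation $(*)$ to an equation $(*)$), and let $G_c$ be the group of transformations that $G$ induces on the space with coordinates $(x,a_{n-3},\dots,a_0)$. Let $X^0=\xi\,\partial_x+\sum_{j=0}^{n-3}\phi_j\,\partial_{a_j}$ be the general infinitesimal generator of $G_c$, that is, the general velocity at the identity of a smooth one-parameter family of such induced transformations. For $p\ge 0$ let $X^0_{(p)}$ be the prolongation of order $p$ of $X^0$ to the jet space with coordinates $x$ and $a_j^{(k)}$ ($0\le j\le n-3$, $0\le k\le p$), the coefficients $a_j$ being regarded as functions of $x$. An invariant of $X^0_{(p)}$ is a smooth function $F$ on an open subset of this jet space such that $X^0_{(p)}F=0$ for all choices of the arbitrary constants in $X^0$. Then the exact number of fundamental (functionally independent) invariants of $X^0_{(p)}$ is $$\mathbf n=\begin{cases}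 n+p\,(n-2)-4, & (n,p)\neq(3,0),\\ 0, & (n,p)=(3,0).\end{cases}$$ That is: there is an open dense subset of the jet space each point of which has an open neighbourhood on which there are $\mathbf n$ invariants whose differentials are linearly independent at every point and of which every invariant is, locally, a smooth function; and on no non-empty open subset of the jet space do there exist more than $\mathbf n$ invariants whose differentials are linearly independent at every point. -/

import Mathlib

open scoped ContDiff Topology

noncomputable section

namespace LinODE

/-- Values of the coefficients `(a_0, …, a_{n-3})` of an equation
`y^(n) + a_{n-3} y^(n-3) + ⋯ + a_0 y = 0`. -/
abbrev Coeff (n : ℕ) : Type := Fin (n - 2) → ℝ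

/-- The space with coordinates `(x, a_0, …, a_{n-3})` on which the induced group acts. -/
abbrev Base (n : ℕ) : Type := ℝ × Coeff n

/-- The jet space of order `p`, with coordinates `x` and `a_j^(k)`, `0 ≤ k ≤ p`, `0 ≤ j ≤ n - 3`;
the coordinate `a_j^(k)` of `z` is `z.2 k j`. -/
abbrev Jet (n p : ℕ) : Type := ℝ × (Fin (p + 1) → Coeff n)

/-- On the set `I` the function `u` solves the equation
`y^(n) + a_{n-3}(x) y^(n-3) + ⋯ + a_0(x) y = 0`. -/
def SolvesOn (n : ℕ) (a : ℝ → Coeff n) (u : ℝ → ℝ) (I : Set ℝ) : Prop :=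
  ∀ t ∈ I, iteratedDeriv n u t + ∑ j : Fin (n - 2), a t j * iteratedDeriv (j : ℕ) u t = 0

/-- The derivatives `d^k Y / dX^k` along a parametrized plane curve `t ↦ (X t, Y t)`, as functions
of the parameter `t`. -/
def curveDeriv (X Y : ℝ → ℝ) : ℕ → ℝ → ℝ
  | 0 => Y
  | k + 1 => fun t => deriv (curveDeriv X Y k) t / deriv X t

/-- A smooth one-parameter family `Φ ε` of local point transformations `(x, y) ↦ (x̄, ȳ)` of the
plane, through the identity at `ε = 0`, that maps every equation of the canonical form to an
equation of the canonical form, together with the family `Ψ ε : (x, a) ↦ (x̄, ā)` of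
transformations it induces on the coefficients: the graph of each solution `u` of the equation
with coefficients `a` is mapped by `Φ ε` to the graph of a solution of the equation whose
coefficient functions are given by the image under `Ψ ε` of the graph of `a`. Transformations such
as `x ↦ x / (1 - ε x)` are only local, so that everything is required for small `ε`, locally
in `x`. -/
structure IsEquivalenceFamily (n : ℕ) (Φ : ℝ → ℝ × ℝ → ℝ × ℝ) (Ψ : ℝ → Base n → Base n) :
    Prop where
  smooth_point : ∃ O : Set (ℝ × (ℝ × ℝ)), IsOpen O ∧ (∀ z, ((0 : ℝ), z) ∈ O) ∧
    ContDiffOn ℝ ∞ (fun q : ℝ × (ℝ × ℝ) => Φ q.1 q.2) O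
  smooth_coeff : ∃ O : Set (ℝ × Base n), IsOpen O ∧ (∀ z, ((0 : ℝ), z) ∈ O) ∧
    ContDiffOn ℝ ∞ (fun q : ℝ × Base n => Ψ q.1 q.2) O
  point_zero : ∀ z, Φ 0 z = z
  coeff_zero : ∀ z, Ψ 0 z = z
  maps_equation : ∀ (I : Set ℝ) (a : ℝ → Coeff n) (u : ℝ → ℝ), IsOpen I →
    ContDiffOn ℝ ∞ a I → ContDiffOn ℝ ∞ u I → SolvesOn n a u I →
    ∀ x₀ ∈ I, ∀ᶠ q : ℝ × ℝ in 𝓝 ((0 : ℝ), x₀),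
      (Φ q.1 (q.2, u q.2)).1 = (Ψ q.1 (q.2, a q.2)).1 ∧
      curveDeriv (fun t => (Φ q.1 (t, u t)).1) (fun t => (Φ q.1 (t, u t)).2) n q.2 +
        ∑ j : Fin (n - 2), (Ψ q.1 (q.2, a q.2)).2 j *
          curveDeriv (fun t => (Φ q.1 (t, u t)).1) (fun t => (Φ q.1 (t, u t)).2) (j : ℕ) q.2 = 0

/-- `W = ξ ∂_x + ∑ φ_j ∂_{a_j}` is an infinitesimal generator (one of the values that the general
generator `X⁰` takes for special choices of its arbitrary constants) of the group induced on the
coefficients by the equivalence group: the velocity at the identity of an induced one-parameter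
family. -/
def IsGenerator (n : ℕ) (W : Base n → Base n) : Prop :=
  ∃ (Φ : ℝ → ℝ × ℝ → ℝ × ℝ) (Ψ : ℝ → Base n → Base n), IsEquivalenceFamily n Φ Ψ ∧
    ∀ z, HasDerivAt (fun ε => Ψ ε z) (W z) 0

/-- The component of the prolongation of `W = ξ ∂_x + ∑ φ_j ∂_{a_j}` along the derivatives of
order `k`, at the jet at `t` of the function `a`:
`D^k (φ - ξ a') + ξ a^(k+1)`, with `D` the total derivative. -/
def prolongCoeff {n : ℕ} (W : Base n → Base n) (a : ℝ → Coeff n) (k : ℕ) (t : ℝ) : Coeff n :=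
  iteratedDeriv k (fun s => (W (s, a s)).2 - (W (s, a s)).1 • deriv a s) t +
    (W (t, a t)).1 • iteratedDeriv (k + 1) a t

/-- The Taylor polynomial with a given jet. -/
def taylorRep {n p : ℕ} (z : Jet n p) : ℝ → Coeff n :=
  fun t => ∑ k : Fin (p + 1), ((t - z.1) ^ (k : ℕ) / (Nat.factorial k : ℝ)) • z.2 k

/-- The prolongation of order `p` of the vector field `W`, a vector field on the jet space. The
components of order at most `p` do not depend on the function that represents the jet. -/
def prolong {n p : ℕ} (W : Base n → Base n) (z : Jet n p) : Jet n p :=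
  ((W (z.1, z.2 0)).1, fun k => prolongCoeff W (taylorRep z) (k : ℕ) z.1)

/-- `F` is a (differential) invariant, on the open set `U` of the jet space, of the `p`-th
prolongation of the generator: it is smooth and annihilated by the prolongation, whatever the
values of the arbitrary constants. -/
def IsInvariantOn {n p : ℕ} (U : Set (Jet n p)) (F : Jet n p → ℝ) : Prop :=
  ContDiffOn ℝ ∞ F U ∧
    ∀ W : Base n → Base n, IsGenerator n W → ∀ z ∈ U, fderiv ℝ F z (prolong W z) = 0

/-- Functional independence on an open set: the differentials are independent at every point. -/
def FunctIndepOn {n p m : ℕ} (U : Set (Jet n p)) (Ψ : Fin m → Jet n p → ℝ) : Prop :=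
  ∀ z ∈ U, LinearIndependent ℝ (fun i => fderiv ℝ (Ψ i) z)

/-- A fundamental system of invariants on the open set `U`: functionally independent invariants
such that every invariant is locally a smooth function of them. -/
structure IsFundamentalSystem {n p m : ℕ} (U : Set (Jet n p)) (Ψ : Fin m → Jet n p → ℝ) :
    Prop where
  invariant : ∀ i, IsInvariantOn U (Ψ i)
  indep : FunctIndepOn U Ψ
  complete : ∀ V ⊆ U, IsOpen V → ∀ F : Jet n p → ℝ, IsInvariantOn V F → ∀ z ∈ V,
    ∃ H : (Fin m → ℝ) → ℝ, ContDiffAt ℝ ∞ H (fun i => Ψ i z) ∧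
      ∀ᶠ w in 𝓝 z, F w = H (fun i => Ψ i w)

/-- The exact number of fundamental invariants of the `p`-th prolongation is `N`: around every
point of an open dense subset of the jet space there is a fundamental system of `N` invariants,
and nowhere are there more than `N` functionally independent invariants. -/
def ExactNumberOfInvariants (n p N : ℕ) : Prop :=
  (∃ Ω : Set (Jet n p), IsOpen Ω ∧ Dense Ω ∧ ∀ z ∈ Ω, ∃ U : Set (Jet n p), IsOpen U ∧ z ∈ U ∧
    ∃ Ψ : Fin N → Jet n p → ℝ, IsFundamentalSystem U Ψ) ∧
  ∀ U : Set (Jet n p), IsOpen U → U.Nonempty → ∀ (m : ℕ) (Ψ : Fin m → Jet n p → ℝ),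
    (∀ i, IsInvariantOn U (Ψ i)) → FunctIndepOn U Ψ → m ≤ N

end LinODE

end

noncomputable section

namespace LinODE

/-! The jet space has dimension 1 + (p+1)(n-2). The invariants are the functions annihilated by the
span of the prolonged generators, which has rank 3 where a_{n-3} ≠ 0 (rank 2 if (n,p) = (3,0)). The
number of invariants is the difference of these two numbers, and an explicit cross-section of the
orbits realizes it.

Generators. The equivalence condition can be localized at a point: given b and a smooth u with u(x)
≠ 0 and `linOp b u x = 0`, changing only the lowest coefficient away from x makes u a solution where
it does not vanish (`coeffSolvedBy`). Differentiating the condition in ε at 0, and then in u in a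
direction w, gives a linear condition at x (`sum_lieTerm_eq_zero`) on ξ, on the y-derivative h of
the y-velocity along u, and on the φ_j. Powers of t - x serve as w. The absent orders n-1 and n-2
force h' = (n-1)/2 · ξ'' and ξ''' = 0; the remaining orders determine every φ_j (`eq_quadField`).
Conversely, affine maps of x and the projective maps x/(1 - εx) realize ξ = 1, x, x²
(`isGenerator_affine`, `isGenerator_projective`).

Invariants. Since ∂_x is itself a generator, the dependence on x can be eliminated, and the
prolonged generators span ∂_x, a linear scaling field and a linear shift field on the fibres
(`prolong_quadField`, `isInvariantOn_iff`). Along the shift a_{n-3} is constant while, unless (n,p)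
= (3,0), some other coordinate moves with speed κ a_{n-3}, κ ≠ 0. On each half a_{n-3} > 0 or
a_{n-3} < 0, scaling normalizes a_{n-3} to ±1 and the shift normalizes the other coordinate to 0;
the remaining coordinates of the normalized jet form a fundamental system
(`isFundamentalSystem_of_section`). For (3,0) the shift field is zero and the half-planes are single
orbits. The upper bound holds because differentials of invariants lie in the span of those of a
fundamental system (`le_of_isFundamentalSystem`). -/

theorem contDiffAt_deriv {E : Type*} [NormedAddCommGroup E] [NormedSpace ℝ E] {f : ℝ → E} {t : ℝ}
    (hf : ContDiffAt ℝ ∞ f t) : ContDiffAt ℝ ∞ (deriv f) t :=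
  (hf.fderiv_right (m := ∞) (by simp)).clm_apply (contDiffAt_const (c := (1 : ℝ)))

theorem contDiffAt_iteratedDeriv {E : Type*} [NormedAddCommGroup E] [NormedSpace ℝ E] {f : ℝ → E}
    {t : ℝ} (k : ℕ) (hf : ContDiffAt ℝ ∞ f t) : ContDiffAt ℝ ∞ (iteratedDeriv k f) t := by
  induction k with
  | zero => simpa using hf
  | succ k ih => rw [iteratedDeriv_succ]; exact contDiffAt_deriv ih

theorem differentiableAt_iteratedDeriv {E : Type*} [NormedAddCommGroup E] [NormedSpace ℝ E]
    {f : ℝ → E} {t : ℝ} (k : ℕ) (hf : ContDiffAt ℝ ∞ f t) :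
    DifferentiableAt ℝ (iteratedDeriv k f) t :=
  (contDiffAt_iteratedDeriv k hf).differentiableAt (by simp)

/-! ### Partial derivatives and velocities of families of curves -/

section Partial

variable {E : Type*} [NormedAddCommGroup E] [NormedSpace ℝ E]

theorem hasDerivAt_comp_left {F : ℝ × E → ℝ} {s : ℝ} {t : E} (hF : DifferentiableAt ℝ F (s, t)) :
    HasDerivAt (fun r => F (r, t)) (fderiv ℝ F (s, t) (1, 0)) s := by
  have h : HasDerivAt (fun r : ℝ => (r, t)) ((1 : ℝ), (0 : E)) s :=
    (hasDerivAt_id s).prodMk (hasDerivAt_const s t)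
  exact hF.hasFDerivAt.comp_hasDerivAt s h

theorem hasDerivAt_comp_right {F : E × ℝ → ℝ} {s : E} {t : ℝ} (hF : DifferentiableAt ℝ F (s, t)) :
    HasDerivAt (fun r => F (s, r)) (fderiv ℝ F (s, t) (0, 1)) t := by
  have h : HasDerivAt (fun r : ℝ => (s, r)) ((0 : E), (1 : ℝ)) t :=
    (hasDerivAt_const t s).prodMk (hasDerivAt_id t)
  exact hF.hasFDerivAt.comp_hasDerivAt t h

theorem eventually_differentiableAt {F : E → ℝ} {q : E} (hF : ContDiffAt ℝ ∞ F q) :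
    ∀ᶠ q' in 𝓝 q, DifferentiableAt ℝ F q' :=
  ((hF.of_le (m := 1) (by exact_mod_cast le_top)).eventually (by simp)).mono
    fun _ h => h.differentiableAt (by simp)

theorem contDiffAt_fderiv_apply {F : E → ℝ} {q : E} (hF : ContDiffAt ℝ ∞ F q)
    (v : E) : ContDiffAt ℝ ∞ (fun q => fderiv ℝ F q v) q :=
  (hF.fderiv_right (m := ∞) (by simp)).clm_apply contDiffAt_const

theorem deriv_right_eventuallyEq {F : E × ℝ → ℝ} {q : E × ℝ} (hF : ContDiffAt ℝ ∞ F q) :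
    (fun q : E × ℝ => deriv (fun t => F (q.1, t)) q.2) =ᶠ[𝓝 q]
      fun q => fderiv ℝ F q (0, 1) :=
  (eventually_differentiableAt hF).mono fun _ h => (hasDerivAt_comp_right h).deriv

theorem deriv_left_eventuallyEq {F : ℝ × E → ℝ} {q : ℝ × E} (hF : ContDiffAt ℝ ∞ F q) :
    (fun q : ℝ × E => deriv (fun s => F (s, q.2)) q.1) =ᶠ[𝓝 q]
      fun q => fderiv ℝ F q (1, 0) :=
  (eventually_differentiableAt hF).mono fun _ h => (hasDerivAt_comp_left h).deriv

theorem contDiffAt_deriv_right {F : E × ℝ → ℝ} {q : E × ℝ} (hF : ContDiffAt ℝ ∞ F q) :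
    ContDiffAt ℝ ∞ (fun q : E × ℝ => deriv (fun t => F (q.1, t)) q.2) q :=
  (contDiffAt_fderiv_apply hF _).congr_of_eventuallyEq (deriv_right_eventuallyEq hF)

theorem contDiffAt_deriv_left {F : ℝ × E → ℝ} {q : ℝ × E} (hF : ContDiffAt ℝ ∞ F q) :
    ContDiffAt ℝ ∞ (fun q : ℝ × E => deriv (fun s => F (s, q.2)) q.1) q :=
  (contDiffAt_fderiv_apply hF _).congr_of_eventuallyEq (deriv_left_eventuallyEq hF)

theorem contDiffAt_slice {F : ℝ × E → ℝ} {s : ℝ} {t : E} (hF : ContDiffAt ℝ ∞ F (s, t)) :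
    ContDiffAt ℝ ∞ (fun r => F (s, r)) t :=
  hF.comp t (contDiffAt_const.prodMk contDiffAt_id)

end Partial

/-- Mixed partial derivatives commute. -/
theorem hasDerivAt_deriv_swap {F : ℝ × ℝ → ℝ} {s t : ℝ} (hF : ContDiffAt ℝ ∞ F (s, t)) :
    HasDerivAt (fun r => deriv (fun t' => F (r, t')) t)
      (deriv (fun t' => deriv (fun r => F (r, t')) s) t) s := by
  have h1 := hasDerivAt_comp_left
    ((contDiffAt_deriv_right hF).differentiableAt (by simp))
  have h2 := hasDerivAt_comp_right
    ((contDiffAt_deriv_left hF).differentiableAt (by simp))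
  have hsymm : IsSymmSndFDerivAt ℝ F (s, t) :=
    hF.isSymmSndFDerivAt (by simpa using (WithTop.coe_le_coe.2 le_top : ((2 : ℕ∞) : WithTop ℕ∞) ≤ ∞))
  have hd : DifferentiableAt ℝ (fderiv ℝ F) (s, t) :=
    (hF.fderiv_right (m := ∞) (by simp)).differentiableAt (by simp)
  have hv : ∀ v w : ℝ × ℝ, fderiv ℝ (fun q => fderiv ℝ F q v) (s, t) w
      = fderiv ℝ (fderiv ℝ F) (s, t) w v := by
    intro v w
    rw [fderiv_clm_apply hd (differentiableAt_const v)]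
    simp
  have e1 := (deriv_right_eventuallyEq hF).fderiv_eq (𝕜 := ℝ)
  have e2 := (deriv_left_eventuallyEq hF).fderiv_eq (𝕜 := ℝ)
  rw [e1, hv] at h1
  rw [e2, hv] at h2
  have h3 : deriv (fun t' => deriv (fun r => F (r, t')) s) t
      = fderiv ℝ (fderiv ℝ F) (s, t) (1, 0) (0, 1) := by
    rw [h2.deriv, hsymm]
  rw [h3]
  exact h1

theorem hasDerivAt_iteratedDeriv_swap (k : ℕ) {F : ℝ × ℝ → ℝ} {s t : ℝ} {J : Set ℝ}
    (hJ : IsOpen J) (ht : t ∈ J) (hF : ∀ t ∈ J, ContDiffAt ℝ ∞ F (s, t)) :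
    HasDerivAt (fun r => iteratedDeriv k (fun t' => F (r, t')) t)
      (iteratedDeriv k (fun t' => deriv (fun r => F (r, t')) s) t) s := by
  induction k generalizing F with
  | zero =>
    simp only [iteratedDeriv_zero]
    exact (hasDerivAt_comp_left ((hF t ht).differentiableAt (by simp))).differentiableAt.hasDerivAt
  | succ k ih =>
    have h := ih (F := fun q => deriv (fun t' => F (q.1, t')) q.2)
      fun t ht => contDiffAt_deriv_right (hF t ht)
    simp only [iteratedDeriv_succ']
    convert h using 1
    refine Filter.EventuallyEq.iteratedDeriv_eq k ?_
    filter_upwards [hJ.mem_nhds ht] with t' ht'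
    exact (hasDerivAt_deriv_swap (hF t' ht')).deriv.symm

/-- The derivatives along a smooth family of parametrized curves that starts with the graph of `u`,
and their velocities at `0`: the prolongation formula. -/
theorem curveDeriv_family {X Y : ℝ × ℝ → ℝ} {u : ℝ → ℝ} {J : Set ℝ} (hJ : IsOpen J)
    (hX : ∀ t ∈ J, ContDiffAt ℝ ∞ X (0, t)) (hY : ∀ t ∈ J, ContDiffAt ℝ ∞ Y (0, t))
    (hX0 : ∀ t ∈ J, X (0, t) = t) (hY0 : ∀ t ∈ J, Y (0, t) = u t) (k : ℕ) :
    ∀ t ∈ J,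
      ContDiffAt ℝ ∞ (fun q : ℝ × ℝ =>
        curveDeriv (fun t => X (q.1, t)) (fun t => Y (q.1, t)) k q.2) (0, t) ∧
      curveDeriv (fun t => X (0, t)) (fun t => Y (0, t)) k t = iteratedDeriv k u t ∧
      deriv (fun ε => curveDeriv (fun t => X (ε, t)) (fun t => Y (ε, t)) k t) 0 =
        iteratedDeriv k (fun t => deriv (fun ε => Y (ε, t)) 0
          - deriv (fun ε => X (ε, t)) 0 * deriv u t) t
        + deriv (fun ε => X (ε, t)) 0 * iteratedDeriv (k + 1) u t := by
  have hu : ∀ t ∈ J, ContDiffAt ℝ ∞ u t := fun t ht =>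
    (contDiffAt_slice (hY t ht)).congr_of_eventuallyEq <| by
      filter_upwards [hJ.mem_nhds ht] with r hr using (hY0 r hr).symm
  have hxi : ∀ t ∈ J, ContDiffAt ℝ ∞ (fun t => deriv (fun ε => X (ε, t)) 0) t := fun t ht =>
    contDiffAt_slice (contDiffAt_deriv_left (hX t ht))
  have heta : ∀ t ∈ J, ContDiffAt ℝ ∞ (fun t => deriv (fun ε => Y (ε, t)) 0) t := fun t ht =>
    contDiffAt_slice (contDiffAt_deriv_left (hY t ht))
  have hdu : ∀ t ∈ J, ContDiffAt ℝ ∞ (deriv u) t := fun t ht => contDiffAt_deriv (hu t ht)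
  have hX1 : ∀ t ∈ J, deriv (fun t' => X (0, t')) t = 1 := fun t ht => by
    have : (fun t' => X (0, t')) =ᶠ[𝓝 t] id := by
      filter_upwards [hJ.mem_nhds ht] with r hr using hX0 r hr
    rw [this.deriv_eq]; simp
  induction k with
  | zero =>
    intro t ht
    refine ⟨hY t ht, by simpa [curveDeriv] using hY0 t ht, ?_⟩
    simp [curveDeriv]
  | succ k ih =>
    intro t ht
    set C : ℝ × ℝ → ℝ := fun q : ℝ × ℝ =>
        curveDeriv (fun t => X (q.1, t)) (fun t => Y (q.1, t)) k q.2 with hC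
    have hCs : ∀ t ∈ J, ContDiffAt ℝ ∞ C (0, t) := fun t ht => (ih t ht).1
    have hC0 : deriv (fun t' => C (0, t')) t = iteratedDeriv (k + 1) u t := by
      have : (fun t' => C (0, t')) =ᶠ[𝓝 t] iteratedDeriv k u := by
        filter_upwards [hJ.mem_nhds ht] with r hr using (ih r hr).2.1
      rw [this.deriv_eq, iteratedDeriv_succ]
    refine ⟨?_, ?_, ?_⟩
    · refine (contDiffAt_deriv_right (hCs t ht)).div (contDiffAt_deriv_right (hX t ht)) ?_
      simp [hX1 t ht]
    · change deriv (fun t' => C (0, t')) t / deriv (fun t' => X (0, t')) t = _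
      rw [hX1 t ht, hC0, div_one]
    · change deriv (fun ε => deriv (fun t' => C (ε, t')) t / deriv (fun t' => X (ε, t')) t) 0 = _
      have hn := hasDerivAt_deriv_swap (hCs t ht)
      have hd := hasDerivAt_deriv_swap (hX t ht)
      have hq := hn.div hd (by simp [hX1 t ht])
      rw [hX1 t ht, hC0] at hq
      refine hq.deriv.trans ?_
      have hCd : (fun t' => deriv (fun ε => C (ε, t')) 0) =ᶠ[𝓝 t] fun t =>
          iteratedDeriv k (fun t => deriv (fun ε => Y (ε, t)) 0
            - deriv (fun ε => X (ε, t)) 0 * deriv u t) t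
          + deriv (fun ε => X (ε, t)) 0 * iteratedDeriv (k + 1) u t := by
        filter_upwards [hJ.mem_nhds ht] with r hr using (ih r hr).2.2
      -- With ξ the x-velocity, the term ξ' u^(k+1) produced by the product rule cancels against the
      -- derivative of the denominator in the quotient rule.
      rw [hCd.deriv_eq, deriv_fun_add, deriv_fun_mul, ← iteratedDeriv_succ, ← iteratedDeriv_succ]
      · ring
      · exact (hxi t ht).differentiableAt (by simp)
      · exact differentiableAt_iteratedDeriv _ (hu t ht)
      · exact differentiableAt_iteratedDeriv _ ((heta t ht).sub ((hxi t ht).mul (hdu t ht)))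
      · exact ((hxi t ht).differentiableAt (by simp)).mul (differentiableAt_iteratedDeriv _ (hu t ht))

/-! ### Equations with a prescribed solution -/

/-- The operator `y ↦ y^(n) + b_{n-3} y^(n-3) + ⋯ + b_0 y` with constant coefficients. -/
def linOp {n : ℕ} (b : Coeff n) (u : ℝ → ℝ) (t : ℝ) : ℝ :=
  iteratedDeriv n u t + ∑ j : Fin (n - 2), b j * iteratedDeriv (j : ℕ) u t

/-- The coefficient functions that differ from `b` only in the lowest coefficient, chosen so that
`u` is a solution. -/
def coeffSolvedBy {n : ℕ} (b : Coeff n) (u : ℝ → ℝ) (t : ℝ) : Coeff n :=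
  fun j => b j - if (j : ℕ) = 0 then linOp b u t / u t else 0

theorem contDiff_iteratedDeriv {u : ℝ → ℝ} (hu : ContDiff ℝ ∞ u) (k : ℕ) :
    ContDiff ℝ ∞ (iteratedDeriv k u) :=
  contDiff_iff_contDiffAt.2 fun _ => contDiffAt_iteratedDeriv k hu.contDiffAt

theorem contDiff_linOp {n : ℕ} (b : Coeff n) {u : ℝ → ℝ} (hu : ContDiff ℝ ∞ u) :
    ContDiff ℝ ∞ (linOp b u) :=
  (contDiff_iteratedDeriv hu n).add
    (ContDiff.sum fun j _ => contDiff_const.mul (contDiff_iteratedDeriv hu j))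

theorem contDiffOn_coeffSolvedBy {n : ℕ} (b : Coeff n) {u : ℝ → ℝ} (hu : ContDiff ℝ ∞ u) :
    ContDiffOn ℝ ∞ (coeffSolvedBy b u) {t | u t ≠ 0} := by
  refine contDiffOn_pi.2 fun j => ?_
  unfold coeffSolvedBy
  by_cases hj : (j : ℕ) = 0
  · simp only [hj, if_true]
    exact contDiffOn_const.sub ((contDiff_linOp b hu).contDiffOn.div hu.contDiffOn fun t ht => ht)
  · simp only [hj, if_false]
    exact contDiffOn_const.sub contDiffOn_const

/-- The lowest coefficient multiplies u itself, so the defect of the equation is absorbed by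
dividing by u; `3 ≤ n` guarantees that this coefficient exists. -/
theorem solvesOn_coeffSolvedBy {n : ℕ} (hn : 3 ≤ n) (b : Coeff n) (u : ℝ → ℝ) :
    SolvesOn n (coeffSolvedBy b u) u {t | u t ≠ 0} := by
  intro t ht
  have h0 : ∀ j : Fin (n - 2), (j : ℕ) = 0 ↔ j = ⟨0, by omega⟩ := fun j => by
    rw [Fin.ext_iff]
  simp only [coeffSolvedBy, sub_mul, Finset.sum_sub_distrib, h0, ite_mul, zero_mul,
    Finset.sum_ite_eq', Finset.mem_univ, if_true, iteratedDeriv_zero]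
  rw [div_mul_cancel₀ _ ht, linOp]
  ring

theorem coeffSolvedBy_eq {n : ℕ} {b : Coeff n} {u : ℝ → ℝ} {t : ℝ} (h : linOp b u t = 0) :
    coeffSolvedBy b u t = b := by
  ext j; simp [coeffSolvedBy, h]

/-! ### The linearized equivalence condition -/

/-- The `x`-component of the velocity at the identity of a family of transformations. -/
def velX (Φ : ℝ → ℝ × ℝ → ℝ × ℝ) (z : ℝ × ℝ) : ℝ := deriv (fun ε => (Φ ε z).1) 0

/-- The `y`-component of the velocity at the identity of a family of transformations. -/
def velY (Φ : ℝ → ℝ × ℝ → ℝ × ℝ) (z : ℝ × ℝ) : ℝ := deriv (fun ε => (Φ ε z).2) 0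

section Family

variable {n : ℕ} {Φ : ℝ → ℝ × ℝ → ℝ × ℝ} {Ψ : ℝ → Base n → Base n} {W : Base n → Base n}

theorem IsEquivalenceFamily.contDiffAt_point (h : IsEquivalenceFamily n Φ Ψ) (z : ℝ × ℝ) :
    ContDiffAt ℝ ∞ (fun q : ℝ × (ℝ × ℝ) => Φ q.1 q.2) (0, z) := by
  obtain ⟨O, hO, h0, hs⟩ := h.smooth_point
  exact hs.contDiffAt (hO.mem_nhds (h0 z))

theorem contDiff_velX (h : IsEquivalenceFamily n Φ Ψ) : ContDiff ℝ ∞ (velX Φ) :=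
  contDiff_iff_contDiffAt.2 fun z =>
    contDiffAt_slice (contDiffAt_deriv_left (h.contDiffAt_point z).fst)

theorem contDiff_velY (h : IsEquivalenceFamily n Φ Ψ) : ContDiff ℝ ∞ (velY Φ) :=
  contDiff_iff_contDiffAt.2 fun z =>
    contDiffAt_slice (contDiffAt_deriv_left (h.contDiffAt_point z).snd)

/-- The infinitesimal form of the condition that equations are mapped to equations. -/
theorem linearized_equation (h : IsEquivalenceFamily n Φ Ψ)
    (hW : ∀ z, HasDerivAt (fun ε => Ψ ε z) (W z) 0) {I : Set ℝ} {a : ℝ → Coeff n} {u : ℝ → ℝ}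
    (hI : IsOpen I) (ha : ContDiffOn ℝ ∞ a I) (hu : ContDiffOn ℝ ∞ u I) (hs : SolvesOn n a u I)
    {x : ℝ} (hx : x ∈ I) :
    velX Φ (x, u x) = (W (x, a x)).1 ∧
    (iteratedDeriv n (fun t => velY Φ (t, u t) - velX Φ (t, u t) * deriv u t) x
      + velX Φ (x, u x) * iteratedDeriv (n + 1) u x) +
    ∑ j : Fin (n - 2),
      ((W (x, a x)).2 j * iteratedDeriv (j : ℕ) u x + a x j *
        (iteratedDeriv (j : ℕ) (fun t => velY Φ (t, u t) - velX Φ (t, u t) * deriv u t) x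
          + velX Φ (x, u x) * iteratedDeriv ((j : ℕ) + 1) u x)) = 0 := by
  have hgraph : ∀ t ∈ I, ContDiffAt ℝ ∞ (fun q : ℝ × ℝ => Φ q.1 (q.2, u q.2)) (0, t) := by
    intro t ht
    have h1 : ContDiffAt ℝ ∞ (fun q : ℝ × ℝ => (q.1, (q.2, u q.2))) (0, t) :=
      contDiffAt_fst.prodMk (contDiffAt_snd.prodMk
        (ContDiffAt.comp (f := Prod.snd) (g := u) (0, t) (hu.contDiffAt (hI.mem_nhds ht))
          contDiffAt_snd))
    exact ContDiffAt.comp (g := fun q : ℝ × (ℝ × ℝ) => Φ q.1 q.2) (0, t)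
      (h.contDiffAt_point (t, u t)) h1
  have hev := (h.maps_equation I a u hI ha hu hs x hx)
  have hev' : ∀ᶠ ε : ℝ in 𝓝 0, _ :=
    (show Filter.Tendsto (fun ε : ℝ => (ε, x)) (𝓝 0) (𝓝 ((0 : ℝ), x)) from
      (Continuous.tendsto (by fun_prop) _)).eventually hev
  have hΨ1 : HasDerivAt (fun ε => (Ψ ε (x, a x)).1) (W (x, a x)).1 0 := (hW (x, a x)).fst
  have hΨ2 : ∀ j, HasDerivAt (fun ε => (Ψ ε (x, a x)).2 j) ((W (x, a x)).2 j) 0 := fun j =>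
    hasDerivAt_pi.1 (hW (x, a x)).snd j
  have hC := curveDeriv_family (X := fun q => (Φ q.1 (q.2, u q.2)).1)
    (Y := fun q => (Φ q.1 (q.2, u q.2)).2) (u := u) hI
    (fun t ht => (hgraph t ht).fst) (fun t ht => (hgraph t ht).snd)
    (fun t _ => by simp [h.point_zero]) (fun t _ => by simp [h.point_zero])
  have hd : ∀ k, HasDerivAt (fun ε => curveDeriv (fun t => (Φ ε (t, u t)).1)
      (fun t => (Φ ε (t, u t)).2) k x)
      (iteratedDeriv k (fun t => velY Φ (t, u t) - velX Φ (t, u t) * deriv u t) x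
        + velX Φ (x, u x) * iteratedDeriv (k + 1) u x) 0 := by
    intro k
    obtain ⟨h1, -, h3⟩ := hC k x hx
    have h4 := (hasDerivAt_comp_left (h1.differentiableAt (by simp))).differentiableAt.hasDerivAt
    rw [h3] at h4
    exact h4
  refine ⟨?_, ?_⟩
  · rw [← hΨ1.deriv]
    exact Filter.EventuallyEq.deriv_eq (hev'.mono fun ε hε => hε.1)
  -- The transformed equation holds at x for all small ε, so its derivative at ε = 0, computed by
  -- the product rule, vanishes.
  · have htot := (hd n).add (HasDerivAt.fun_sum (u := Finset.univ)
      fun (j : Fin (n - 2)) _ => (hΨ2 j).mul (hd j))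
    have hzero : HasDerivAt (fun _ : ℝ => (0 : ℝ)) 0 0 := hasDerivAt_const _ _
    have := htot.unique (hzero.congr_of_eventuallyEq (hev'.mono fun ε hε => hε.2))
    rw [← this]
    congr 1
    refine Finset.sum_congr rfl fun j _ => ?_
    have e1 : (Ψ 0 (x, a x)).2 j = a x j := by rw [h.coeff_zero]
    have e2 := (hC j x hx).2.1
    rw [e1]
    erw [e2]

/-- `(x - x₀)^i / i!` -/
def monom (x : ℝ) (i : ℕ) (t : ℝ) : ℝ := (t - x) ^ i / (Nat.factorial i : ℝ)

theorem contDiff_monom (x : ℝ) (i : ℕ) : ContDiff ℝ ∞ (monom x i) := by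
  unfold monom; fun_prop

theorem monom_zero (x : ℝ) : monom x 0 = fun _ => 1 := by ext; simp [monom]

theorem deriv_monom_succ (x : ℝ) (i : ℕ) : deriv (monom x (i + 1)) = monom x i := by
  ext t
  have h := (((hasDerivAt_id t).sub_const x).pow (i + 1)).div_const
    ((Nat.factorial (i + 1) : ℕ) : ℝ)
  refine h.deriv.trans ?_
  rw [Nat.factorial_succ, monom]
  push_cast
  have := Nat.factorial_pos i
  field_simp
  simp

theorem iteratedDeriv_monom (x : ℝ) (k i : ℕ) :
    iteratedDeriv k (monom x i) x = if k = i then 1 else 0 := by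
  induction k generalizing i with
  | zero =>
    cases i <;> simp [monom]
  | succ k ih =>
    cases i with
    | zero => simp [monom_zero, iteratedDeriv_const]
    | succ i => simp [iteratedDeriv_succ', deriv_monom_succ, ih]

theorem iteratedDeriv_mul_monom {f : ℝ → ℝ} {x : ℝ} (hf : ContDiffAt ℝ ∞ f x) (k i : ℕ) :
    iteratedDeriv k (fun t => f t * monom x i t) x
      = (k.choose i : ℝ) * iteratedDeriv (k - i) f x := by
  have h1 : ∀ {g : ℝ → ℝ}, ContDiffAt ℝ ∞ g x → ContDiffAt ℝ k g x := fun hg =>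
    hg.of_le (by exact_mod_cast le_top)
  have := iteratedDeriv_fun_mul (n := k) (h1 (contDiff_monom x i).contDiffAt) (h1 hf)
  simp only [mul_comm (f _)]
  rw [this]
  simp only [iteratedDeriv_monom, mul_ite, mul_one, mul_zero, ite_mul, zero_mul,
    Finset.sum_ite_eq', Finset.mem_range]
  split_ifs with h
  · rfl
  · rw [Nat.choose_eq_zero_of_lt (by omega)]; simp

end Family

/-- The term `D^k (h w - ξ w') + ξ w^(k+1)` at `x`. -/
def lieTerm (h ξ w : ℝ → ℝ) (x : ℝ) (k : ℕ) : ℝ :=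
  iteratedDeriv k (fun t => h t * w t - ξ t * deriv w t) x + ξ x * iteratedDeriv (k + 1) w x

theorem iteratedDeriv_add_smul {f g : ℝ → ℝ} {x : ℝ} (hf : ContDiffAt ℝ ∞ f x)
    (hg : ContDiffAt ℝ ∞ g x) (c : ℝ) (k : ℕ) :
    iteratedDeriv k (fun t => f t + c * g t) x
      = iteratedDeriv k f x + c * iteratedDeriv k g x := by
  have h1 : ∀ {g : ℝ → ℝ}, ContDiffAt ℝ ∞ g x → ContDiffAt ℝ k g x := fun hg =>
    hg.of_le (by exact_mod_cast le_top)
  have h2 : ContDiffAt ℝ k (fun t => c * g t) x := contDiffAt_const.mul (h1 hg)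
  have := iteratedDeriv_fun_add (h1 hf) h2
  rw [this, iteratedDeriv_const_mul_field]

theorem lieTerm_zero_index {h ξ : ℝ → ℝ} {x : ℝ} (k : ℕ) :
    lieTerm h ξ (monom x 0) x k = iteratedDeriv k h x := by
  simp [lieTerm, monom_zero, iteratedDeriv_succ']

theorem lieTerm_succ_index {h ξ : ℝ → ℝ} {x : ℝ} (hh : ContDiffAt ℝ ∞ h x)
    (hξ : ContDiffAt ℝ ∞ ξ x) (k i : ℕ) :
    lieTerm h ξ (monom x (i + 1)) x k = (k.choose (i + 1) : ℝ) * iteratedDeriv (k - (i + 1)) h x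
      - (k.choose i : ℝ) * iteratedDeriv (k - i) ξ x + if k = i then ξ x else 0 := by
  have h2 : ∀ i, ContDiffAt ℝ ∞ (monom x i) x := fun i => (contDiff_monom x i).contDiffAt
  have := iteratedDeriv_add_smul (hh.mul (h2 (i + 1))) (hξ.mul (h2 i)) (-1) k
  rw [lieTerm, deriv_monom_succ, iteratedDeriv_monom]
  simp only [sub_eq_add_neg, neg_mul, one_mul] at this ⊢
  rw [this, iteratedDeriv_mul_monom hh, iteratedDeriv_mul_monom hξ]
  simp

theorem lieTerm_add_smul {h ξ v w : ℝ → ℝ} {x : ℝ} (hh : ContDiffAt ℝ ∞ h x)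
    (hξ : ContDiffAt ℝ ∞ ξ x) (hv : ContDiff ℝ ∞ v) (hw : ContDiff ℝ ∞ w) (c : ℝ) (k : ℕ) :
    lieTerm h ξ (fun t => v t + c * w t) x k = lieTerm h ξ v x k + c * lieTerm h ξ w x k := by
  have hd : deriv (fun t => v t + c * w t) = fun t => deriv v t + c * deriv w t := by
    ext t
    have h1 : DifferentiableAt ℝ v t := hv.contDiffAt.differentiableAt (by simp)
    have h2 : DifferentiableAt ℝ w t := hw.contDiffAt.differentiableAt (by simp)
    rw [deriv_fun_add h1 (h2.const_mul c), deriv_const_mul_field]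
  have hdv : ContDiffAt ℝ ∞ (deriv v) x := contDiffAt_deriv hv.contDiffAt
  have hdw : ContDiffAt ℝ ∞ (deriv w) x := contDiffAt_deriv hw.contDiffAt
  have e := iteratedDeriv_add_smul ((hh.mul hv.contDiffAt).sub (hξ.mul hdv))
    ((hh.mul hw.contDiffAt).sub (hξ.mul hdw)) c k
  rw [lieTerm, hd, iteratedDeriv_add_smul hv.contDiffAt hw.contDiffAt]
  have e' : (fun t => h t * (v t + c * w t) - ξ t * (deriv v t + c * deriv w t)) =
      fun t => (h t * v t - ξ t * deriv v t) + c * (h t * w t - ξ t * deriv w t) := by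
    ext t; ring
  rw [e']
  simp only [lieTerm]
  rw [e]
  ring

theorem linOp_add_smul {n : ℕ} (b : Coeff n) {v w : ℝ → ℝ} (hv : ContDiff ℝ ∞ v)
    (hw : ContDiff ℝ ∞ w) (c x : ℝ) :
    linOp b (fun t => v t + c * w t) x = linOp b v x + c * linOp b w x := by
  simp only [linOp, iteratedDeriv_add_smul hv.contDiffAt hw.contDiffAt, mul_add,
    Finset.sum_add_distrib, Finset.mul_sum]
  rw [add_add_add_comm]
  congr 2
  exact Finset.sum_congr rfl fun j _ => by ring

theorem linOp_monom {n : ℕ} (b : Coeff n) (x : ℝ) (i : Fin (n - 2)) :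
    linOp b (monom x i) x = b i := by
  have : n ≠ i := by omega
  simp only [linOp, iteratedDeriv_monom, this, if_false, zero_add, mul_ite, mul_one, mul_zero,
    ← Fin.ext_iff, Finset.sum_ite_eq', Finset.mem_univ, if_true]

/-- Degrees n-2 and n-1 correspond to the orders missing from the canonical form, so these powers
are admissible directions for every b; they yield the constraints on ξ. -/
theorem linOp_monom_of_lt {n : ℕ} (b : Coeff n) (x : ℝ) {i : ℕ} (h : n - 2 ≤ i) (hi : i < n) :
    linOp b (monom x i) x = 0 := by
  have h1 : n ≠ i := by omega
  have h2 : ∀ j : Fin (n - 2), (j : ℕ) ≠ i := fun j => by omega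
  simp [linOp, iteratedDeriv_monom, h1, h2]

theorem linOp_monom_self {n : ℕ} (hn : 3 ≤ n) (b : Coeff n) (x : ℝ) :
    linOp b (monom x n) x = 1 := by
  have h2 : ∀ j : Fin (n - 2), (j : ℕ) ≠ n := fun j => by omega
  simp [linOp, iteratedDeriv_monom, h2]

section Family

variable {n : ℕ} {Φ : ℝ → ℝ × ℝ → ℝ × ℝ} {Ψ : ℝ → Base n → Base n} {W : Base n → Base n}

/-- One side does not involve b, the other does not involve v: hence ξ depends on x alone as long as
y ≠ 0. The value v = 0 is excluded because a solution can be prescribed only where it does not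
vanish. -/
theorem velX_eq (hn : 3 ≤ n) (h : IsEquivalenceFamily n Φ Ψ)
    (hW : ∀ z, HasDerivAt (fun ε => Ψ ε z) (W z) 0) (x : ℝ) (b : Coeff n) {v : ℝ} (hv : v ≠ 0) :
    velX Φ (x, v) = (W (x, b)).1 := by
  -- The term of degree n leaves u(x) = v unchanged and corrects the n-th derivative so that the
  -- operator annihilates u at x.
  set u : ℝ → ℝ := fun t => v * monom x 0 t + (-(b ⟨0, by omega⟩ * v)) * monom x n t with hu
  have huv : u x = v := by
    have : n ≠ 0 := by omega
    simp [hu, monom, this]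
  have hus : ContDiff ℝ ∞ u :=
    (contDiff_const.mul (contDiff_monom x 0)).add (contDiff_const.mul (contDiff_monom x n))
  have hL : linOp b u x = 0 := by
    have e : (fun t => v * monom x 0 t) = fun t => (fun _ => (0 : ℝ)) t + v * monom x 0 t := by
      ext; simp
    have e0 : linOp b (fun _ => (0 : ℝ)) x = 0 := by simp [linOp]
    have e1 := linOp_monom b x ⟨0, by omega⟩
    rw [hu, linOp_add_smul b (contDiff_const.mul (contDiff_monom x 0)) (contDiff_monom x n), e,
      linOp_add_smul b contDiff_const (contDiff_monom x 0), e0, linOp_monom_self hn]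
    simp only at e1
    rw [e1]; ring
  have := (linearized_equation h hW (I := {t | u t ≠ 0}) (isOpen_ne_fun hus.continuous continuous_const)
    (contDiffOn_coeffSolvedBy b hus) hus.contDiffOn (solvesOn_coeffSolvedBy hn b u)
    (x := x) (by simpa [huv] using hv)).1
  rwa [coeffSolvedBy_eq hL, huv] at this

/-- The function u solves, near x, an equation whose coefficients take the value b at x, so that no
trace of the equation away from x remains. The independence of ξ from y allows its evaluation at y =
1. -/
theorem linearized_equation_at (hn : 3 ≤ n) (h : IsEquivalenceFamily n Φ Ψ)
    (hW : ∀ z, HasDerivAt (fun ε => Ψ ε z) (W z) 0) {x : ℝ} {b : Coeff n} {u : ℝ → ℝ}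
    (hu : ContDiff ℝ ∞ u) (hux : u x ≠ 0) (hL : linOp b u x = 0) :
    (iteratedDeriv n (fun t => velY Φ (t, u t) - velX Φ (t, 1) * deriv u t) x
      + velX Φ (x, 1) * iteratedDeriv (n + 1) u x) +
    ∑ j : Fin (n - 2),
      ((W (x, b)).2 j * iteratedDeriv (j : ℕ) u x + b j *
        (iteratedDeriv (j : ℕ) (fun t => velY Φ (t, u t) - velX Φ (t, 1) * deriv u t) x
          + velX Φ (x, 1) * iteratedDeriv ((j : ℕ) + 1) u x)) = 0 := by
  have hI : IsOpen {t | u t ≠ 0} := isOpen_ne_fun hu.continuous continuous_const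
  have := (linearized_equation h hW hI
    (contDiffOn_coeffSolvedBy b hu) hu.contDiffOn (solvesOn_coeffSolvedBy hn b u)
    (x := x) hux).2
  rw [coeffSolvedBy_eq hL] at this
  have hX : ∀ t, u t ≠ 0 → velX Φ (t, u t) = velX Φ (t, 1) := fun t ht => by
    rw [velX_eq hn h hW t b ht, velX_eq hn h hW t b one_ne_zero]
  have hev : (fun t => velY Φ (t, u t) - velX Φ (t, u t) * deriv u t) =ᶠ[𝓝 x]
      fun t => velY Φ (t, u t) - velX Φ (t, 1) * deriv u t := by
    filter_upwards [hI.mem_nhds hux] with t ht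
    rw [hX t ht]
  simpa only [hev.iteratedDeriv_eq, hX x hux] using this

/-- The derivative of the `y`-component of the velocity in the direction of `y`, along `u`. -/
def velYderiv (Φ : ℝ → ℝ × ℝ → ℝ × ℝ) (u : ℝ → ℝ) (t : ℝ) : ℝ :=
  deriv (fun y => velY Φ (t, y)) (u t)

theorem contDiff_velYderiv (h : IsEquivalenceFamily n Φ Ψ) {u : ℝ → ℝ} (hu : ContDiff ℝ ∞ u) :
    ContDiff ℝ ∞ (velYderiv Φ u) := by
  refine contDiff_iff_contDiffAt.2 fun t => ?_
  exact ContDiffAt.comp (f := fun t => (t, u t)) t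
    (contDiffAt_deriv_right (contDiff_velY h).contDiffAt) (contDiffAt_id.prodMk hu.contDiffAt)

/-- The linearization of the condition on the generator along a family of solutions. -/
theorem sum_lieTerm_eq_zero (hn : 3 ≤ n) (h : IsEquivalenceFamily n Φ Ψ)
    (hW : ∀ z, HasDerivAt (fun ε => Ψ ε z) (W z) 0) {x : ℝ} {b : Coeff n} {u w : ℝ → ℝ}
    (hu : ContDiff ℝ ∞ u) (hw : ContDiff ℝ ∞ w) (hux : u x ≠ 0) (hL : linOp b u x = 0)
    (hLw : linOp b w x = 0) :
    lieTerm (velYderiv Φ u) (fun t => velX Φ (t, 1)) w x n + ∑ j : Fin (n - 2),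
      ((W (x, b)).2 j * iteratedDeriv (j : ℕ) w x +
        b j * lieTerm (velYderiv Φ u) (fun t => velX Φ (t, 1)) w x j) = 0 := by
  have hdu : ContDiff ℝ ∞ (deriv u) := by simpa using contDiff_iteratedDeriv hu 1
  have hdw : ContDiff ℝ ∞ (deriv w) := by simpa using contDiff_iteratedDeriv hw 1
  have hF : ContDiff ℝ ∞ (fun q : ℝ × ℝ => velY Φ (q.2, u q.2 + q.1 * w q.2)
      - velX Φ (q.2, 1) * (deriv u q.2 + q.1 * deriv w q.2)) := by
    have h1 := contDiff_velX h
    have h2 := contDiff_velY h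
    fun_prop
  have hd : ∀ s, deriv (fun t => u t + s * w t) = fun t => deriv u t + s * deriv w t := by
    intro s; ext t
    have h1 : DifferentiableAt ℝ u t := hu.contDiffAt.differentiableAt (by simp)
    have h2 : DifferentiableAt ℝ w t := hw.contDiffAt.differentiableAt (by simp)
    rw [deriv_fun_add h1 (h2.const_mul s), deriv_const_mul_field]
  have hpart : ∀ t, deriv (fun s : ℝ => velY Φ (t, u t + s * w t)
      - velX Φ (t, 1) * (deriv u t + s * deriv w t)) 0
      = velYderiv Φ u t * w t - velX Φ (t, 1) * deriv w t := by
    intro t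
    have hy : HasDerivAt (fun y => velY Φ (t, y)) (velYderiv Φ u t) (u t + 0 * w t) := by
      rw [zero_mul, add_zero]
      have : ContDiff ℝ ∞ fun y => velY Φ (t, y) := by have := contDiff_velY h; fun_prop
      exact (this.contDiffAt.differentiableAt (by simp)).hasDerivAt
    have hl : ∀ c d : ℝ, HasDerivAt (fun s : ℝ => c + s * d) d 0 := fun c d => by
      simpa using ((hasDerivAt_id (0 : ℝ)).mul_const d).const_add c
    exact ((hy.comp 0 (hl (u t) (w t))).sub ((hl _ _).const_mul _)).deriv
  have hterm : ∀ k, HasDerivAt (fun s => iteratedDeriv k (fun t => velY Φ (t, u t + s * w t)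
      - velX Φ (t, 1) * (deriv u t + s * deriv w t)) x + velX Φ (x, 1) *
        (iteratedDeriv (k + 1) u x + s * iteratedDeriv (k + 1) w x))
      (lieTerm (velYderiv Φ u) (fun t => velX Φ (t, 1)) w x k) 0 := by
    intro k
    have h1 := hasDerivAt_iteratedDeriv_swap k (s := 0) (t := x) isOpen_univ (Set.mem_univ x)
      (fun t _ => hF.contDiffAt (x := (0, t)))
    simp only [hpart] at h1
    refine h1.add (HasDerivAt.const_mul _ ?_)
    simpa using ((hasDerivAt_id (0 : ℝ)).mul_const (iteratedDeriv (k + 1) w x)).const_add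
      (iteratedDeriv (k + 1) u x)
  have htot := (hterm n).add (HasDerivAt.fun_sum (u := Finset.univ)
      fun (j : Fin (n - 2)) _ => (((((hasDerivAt_id (0 : ℝ)).mul_const
        (iteratedDeriv j w x)).const_add (iteratedDeriv j u x)).const_mul
        ((W (x, b)).2 j)).add ((hterm j).const_mul (b j))))
  have hzero : HasDerivAt (fun _ : ℝ => (0 : ℝ)) 0 0 := hasDerivAt_const _ _
  have hne : ∀ᶠ s : ℝ in 𝓝 0, u x + s * w x ≠ 0 := by
    have : Filter.Tendsto (fun s : ℝ => u x + s * w x) (𝓝 0) (𝓝 (u x + 0 * w x)) :=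
      Continuous.tendsto (by fun_prop) _
    exact this.eventually_ne (by simpa using hux)
  refine Eq.trans ?_ (htot.unique (hzero.congr_of_eventuallyEq ?_))
  · simp
  -- For small s the function u + s w is nonzero at x and still annihilated there by the operator;
  -- the condition therefore holds along the whole segment and may be differentiated at s = 0.
  · filter_upwards [hne] with s hs
    have := linearized_equation_at hn h hW (x := x) (b := b) (u := fun t => u t + s * w t)
      (hu.add (contDiff_const.mul hw)) hs (by rw [linOp_add_smul b hu hw, hL, hLw]; simp)
    simp only [hd, iteratedDeriv_add_smul hu.contDiffAt hw.contDiffAt] at this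
    exact this

end Family

/-! ### Determination of the generators -/

/-- The coefficient following `b_j`, which is `0` for the highest one. -/
def nextCoeff {n : ℕ} (b : Coeff n) (j : Fin (n - 2)) : ℝ :=
  if h : (j : ℕ) + 1 < n - 2 then b ⟨j + 1, h⟩ else 0

theorem sum_mul_ite_eq_nextCoeff {n : ℕ} (b : Coeff n) (i : Fin (n - 2)) (c : ℝ) :
    ∑ j : Fin (n - 2), b j * (if (j : ℕ) = i + 1 then c else 0) = nextCoeff b i * c := by
  unfold nextCoeff
  split_ifs with hlt
  · rw [Finset.sum_eq_single ⟨i + 1, hlt⟩]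
    · simp
    · intro j _ hj
      rw [if_neg (fun e => hj (Fin.ext e)), mul_zero]
    · simp
  · rw [Finset.sum_eq_zero, zero_mul]
    intro j _
    rw [if_neg (by omega), mul_zero]

/-- The generator with `ξ = c₀ + c₁ x + c₂ x²`. -/
def quadField (n : ℕ) (c₀ c₁ c₂ : ℝ) (z : Base n) : Base n :=
  (c₀ + c₁ * z.1 + c₂ * z.1 ^ 2, fun j =>
    -((n - j : ℝ) * (c₁ + 2 * c₂ * z.1) * z.2 j)
      - (j + 1 : ℝ) * (n - 1 - j) * c₂ * nextCoeff z.2 j)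

theorem eq_quadratic_of_iteratedDeriv_three {f : ℝ → ℝ} (hf : ContDiff ℝ ∞ f)
    (h : ∀ x, iteratedDeriv 3 f x = 0) :
    ∃ c₀ c₁ c₂ : ℝ, ∀ x, f x = c₀ + c₁ * x + c₂ * x ^ 2 ∧ deriv f x = c₁ + 2 * c₂ * x ∧
      iteratedDeriv 2 f x = 2 * c₂ := by
  have hd : ∀ k, Differentiable ℝ (iteratedDeriv k f) := fun k =>
    (contDiff_iteratedDeriv hf k).differentiable (by simp)
  have h2 : ∀ x, iteratedDeriv 2 f x = iteratedDeriv 2 f 0 := fun x =>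
    is_const_of_deriv_eq_zero (hd 2) (fun x => by rw [← iteratedDeriv_succ]; exact h x) x 0
  have h1 : ∀ x, iteratedDeriv 1 f x = iteratedDeriv 1 f 0 + iteratedDeriv 2 f 0 * x := by
    intro x
    have hh : ∀ y, HasDerivAt (fun y => iteratedDeriv 1 f y - iteratedDeriv 2 f 0 * y)
        0 y := fun y => by
      refine (((hd 1) y).hasDerivAt.sub
        ((hasDerivAt_id y).const_mul (iteratedDeriv 2 f 0))).congr_deriv ?_
      rw [← iteratedDeriv_succ, h2 y]
      simp
    have := is_const_of_deriv_eq_zero (fun y => (hh y).differentiableAt) (fun y => (hh y).deriv) x 0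
    simp only [mul_zero, sub_zero] at this
    linarith
  have h0 : ∀ x, f x = f 0 + iteratedDeriv 1 f 0 * x + iteratedDeriv 2 f 0 / 2 * x ^ 2 := by
    intro x
    have hh : ∀ y, HasDerivAt (fun y => f y - (iteratedDeriv 1 f 0 * y
        + iteratedDeriv 2 f 0 / 2 * y ^ 2)) 0 y := fun y => by
      have e : HasDerivAt f (iteratedDeriv 1 f y) y := by
        rw [iteratedDeriv_one]; exact (hf.differentiable (by simp) y).hasDerivAt
      refine (e.sub (((hasDerivAt_id y).const_mul (iteratedDeriv 1 f 0)).add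
        ((hasDerivAt_pow 2 y).const_mul (iteratedDeriv 2 f 0 / 2)))).congr_deriv ?_
      rw [h1 y]; simp; ring
    have := is_const_of_deriv_eq_zero (fun y => (hh y).differentiableAt) (fun y => (hh y).deriv) x 0
    simp only [mul_zero, sub_zero, ne_eq, OfNat.ofNat_ne_zero, not_false_eq_true, zero_pow,
      add_zero] at this
    linarith
  refine ⟨f 0, iteratedDeriv 1 f 0, iteratedDeriv 2 f 0 / 2, fun x => ⟨h0 x, ?_, ?_⟩⟩
  · rw [← iteratedDeriv_one, h1 x]; ring
  · rw [h2 x]; ring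

section Family

variable {n : ℕ} {Φ : ℝ → ℝ × ℝ → ℝ × ℝ} {Ψ : ℝ → Base n → Base n} {W : Base n → Base n}

theorem contDiff_velX_slice (h : IsEquivalenceFamily n Φ Ψ) :
    ContDiff ℝ ∞ fun t => velX Φ (t, 1) := by
  have := contDiff_velX h
  fun_prop

/-- The direction w is the power of degree i+1, which is n-2 or n-1. All orders below n contribute
nothing, and the term of order n gives the identity by the Leibniz rule. -/
theorem lieTerm_high_eq_zero (hn : 3 ≤ n) (h : IsEquivalenceFamily n Φ Ψ)
    (hW : ∀ z, HasDerivAt (fun ε => Ψ ε z) (W z) 0) {u : ℝ → ℝ} (hu : ContDiff ℝ ∞ u) {x : ℝ}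
    (hux : u x ≠ 0) {i : ℕ} (hi : n - 3 ≤ i) (hin : i + 1 < n) :
    (n.choose (i + 1) : ℝ) * iteratedDeriv (n - (i + 1)) (velYderiv Φ u) x
      = (n.choose i : ℝ) * iteratedDeriv (n - i) (fun t => velX Φ (t, 1)) x := by
  -- Any u with u(x) ≠ 0 is admissible once the lowest coefficient is chosen so that the operator
  -- annihilates u at x.
  set b : Coeff n := fun j => if (j : ℕ) = 0 then -(iteratedDeriv n u x / u x) else 0 with hb
  have hL : linOp b u x = 0 := by
    have h0 : ∀ j : Fin (n - 2), (j : ℕ) = 0 ↔ j = ⟨0, by omega⟩ := fun j => by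
      rw [Fin.ext_iff]
    simp only [linOp, hb, h0, ite_mul, zero_mul, Finset.sum_ite_eq', Finset.mem_univ, if_true,
      iteratedDeriv_zero]
    field_simp
    ring
  have hh := (contDiff_velYderiv h hu).contDiffAt (x := x)
  have hξ := (contDiff_velX_slice h).contDiffAt (x := x)
  have := sum_lieTerm_eq_zero hn h hW hu (contDiff_monom x (i + 1)) hux hL
    (linOp_monom_of_lt b x (by omega) hin)
  rw [Finset.sum_eq_zero, lieTerm_succ_index hh hξ, if_neg (by omega)] at this
  · linarith
  -- Here j ≤ n-3 ≤ i, so both binomial terms vanish unless j = i, where -ξ from the Leibniz rule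
  -- cancels +ξ.
  · intro j _
    have hj := j.2
    have h1 : (j : ℕ).choose (i + 1) = 0 := Nat.choose_eq_zero_of_lt (by omega)
    rw [lieTerm_succ_index hh hξ, iteratedDeriv_monom, if_neg (by omega), h1]
    by_cases hji : (j : ℕ) = i
    · simp [hji]
    · have h2 : (j : ℕ).choose i = 0 := Nat.choose_eq_zero_of_lt (by omega)
      simp [hji, h2]

/-- This is the condition from the missing order n-1: the case i = n-2, where n h' = C(n,2) ξ''. -/
theorem deriv_velYderiv (hn : 3 ≤ n) (h : IsEquivalenceFamily n Φ Ψ)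
    (hW : ∀ z, HasDerivAt (fun ε => Ψ ε z) (W z) 0) {u : ℝ → ℝ} (hu : ContDiff ℝ ∞ u) {x : ℝ}
    (hux : u x ≠ 0) :
    deriv (velYderiv Φ u) x
      = (n - 1 : ℝ) / 2 * iteratedDeriv 2 (fun t => velX Φ (t, 1)) x := by
  obtain ⟨m, rfl⟩ : ∃ m, n = m + 2 := ⟨n - 2, by omega⟩
  have := lieTerm_high_eq_zero hn h hW hu hux (i := m) (by omega) (by omega)
  rw [show m + 2 - (m + 1) = 1 by omega, show m + 2 - m = 2 by omega, iteratedDeriv_one,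
    Nat.choose_symm_of_eq_add (show m + 2 = (m + 1) + 1 by omega), Nat.choose_one_right,
    Nat.choose_symm_of_eq_add (show m + 2 = m + 2 by omega), Nat.cast_choose_two] at this
  push_cast at this ⊢
  have h0 : (m + 2 : ℝ) ≠ 0 := by positivity
  refine mul_left_cancel₀ h0 ?_
  rw [this]; ring

/-- The missing order n-2 gives C(n,n-2) h'' = C(n,n-3) ξ''', while differentiating the condition
from order n-1 gives h'' = (n-1)/2 · ξ'''. The two are incompatible unless ξ''' = 0. -/
theorem iteratedDeriv_three_velX (hn : 3 ≤ n) (h : IsEquivalenceFamily n Φ Ψ)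
    (hW : ∀ z, HasDerivAt (fun ε => Ψ ε z) (W z) 0) (x : ℝ) :
    iteratedDeriv 3 (fun t => velX Φ (t, 1)) x = 0 := by
  have hd : deriv (velYderiv Φ fun _ => 1)
      = fun x => (n - 1 : ℝ) / 2 * iteratedDeriv 2 (fun t => velX Φ (t, 1)) x := by
    ext y
    exact deriv_velYderiv hn h hW contDiff_const one_ne_zero
  obtain ⟨m, rfl⟩ : ∃ m, n = m + 3 := ⟨n - 3, by omega⟩
  have := lieTerm_high_eq_zero hn h hW (u := fun _ => 1) (x := x) contDiff_const one_ne_zero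
    (i := m) (by omega) (by omega)
  rw [show m + 3 - (m + 1) = 1 + 1 by omega, show m + 3 - m = 3 by omega, iteratedDeriv_succ',
    hd, iteratedDeriv_const_mul_field, iteratedDeriv_one, ← iteratedDeriv_succ] at this
  have hc : ((m + 3).choose (m + 1) : ℝ) * (m + 1) = ((m + 3).choose m : ℝ) * 3 := by
    have := Nat.choose_succ_right_eq (m + 3) m
    rw [show m + 3 - m = 3 by omega] at this
    exact_mod_cast this
  have hpos : (0 : ℝ) < (m + 3).choose (m + 1) := by
    exact_mod_cast Nat.choose_pos (by omega)
  push_cast at this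
  -- The bracket equals (n-1)/2 - (n-2)/3 = (n+1)/6 with n = m + 3, which is positive.
  have key : ((m + 3).choose (m + 1) : ℝ) * ((m + 3 - 1) / 2 - (m + 1) / 3)
      * iteratedDeriv 3 (fun t => velX Φ (t, 1)) x = 0 := by
    linear_combination this - hc / 3 * iteratedDeriv 3 (fun t => velX Φ (t, 1)) x
  refine (mul_eq_zero.1 key).resolve_left ?_
  have : ((m : ℝ) + 3 - 1) / 2 - (m + 1) / 3 > 0 := by
    have : (0 : ℝ) ≤ m := Nat.cast_nonneg m
    linarith
  positivity

/-- The values of the terms of the linearized equation for monomials, when `ξ` is quadratic and the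
derivative of `h` is constant. -/
theorem lieTerm_monom {h ξ : ℝ → ℝ} {x p q r : ℝ} (hh : ContDiffAt ℝ ∞ h x)
    (hξ : ContDiffAt ℝ ∞ ξ x) (hp : deriv ξ x = p) (hq : iteratedDeriv 2 ξ x = q)
    (hq' : ∀ k, 3 ≤ k → iteratedDeriv k ξ x = 0) (hr : deriv h x = r)
    (hr' : ∀ k, 2 ≤ k → iteratedDeriv k h x = 0) (k i : ℕ) :
    lieTerm h ξ (monom x i) x k = (if k = i then h x - i * p else 0)
      + if k = i + 1 then (i + 1 : ℝ) * (r - i / 2 * q) else 0 := by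
  cases i with
  | zero =>
    rw [lieTerm_zero_index]
    rcases k with _ | _ | k
    · simp
    · simp [iteratedDeriv_one, hr]
    · simp [hr']
  | succ i =>
    rw [lieTerm_succ_index hh hξ]
    rcases lt_or_ge k (i + 1) with hk | hk
    · rw [Nat.choose_eq_zero_of_lt hk, if_neg (show ¬k = i + 1 by omega),
        if_neg (show ¬k = i + 1 + 1 by omega)]
      by_cases hki : k = i
      · simp [hki]
      · rw [Nat.choose_eq_zero_of_lt (by omega), if_neg hki]; simp
    · obtain ⟨d, rfl⟩ := Nat.exists_eq_add_of_le hk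
      rw [show i + 1 + d - (i + 1) = d by omega, show i + 1 + d - i = d + 1 by omega]
      rcases d with _ | _ | d
      · simp [hp]
      · have e : ((i + 1 + (0 + 1)).choose i : ℝ) = (i + 2) * (i + 1) / 2 := by
          rw [show i + 1 + (0 + 1) = i + 2 by omega,
            Nat.choose_symm_of_eq_add (show i + 2 = i + 2 by omega), Nat.cast_choose_two]
          push_cast; ring
        rw [e, if_neg (by omega), if_neg (by omega), if_pos (by omega)]
        rw [show i + 1 + (0 + 1) = (i + 1) + 1 by omega, Nat.choose_succ_self_right]
        simp only [zero_add, iteratedDeriv_one, hr, Nat.reduceAdd, hq]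
        push_cast
        ring
      · rw [hr' _ (by omega), hq' _ (by omega), if_neg (by omega), if_neg (by omega),
          if_neg (by omega)]
        simp

theorem eq_quadField (hn : 3 ≤ n) (hgen : IsGenerator n W) :
    ∃ c₀ c₁ c₂ : ℝ, W = quadField n c₀ c₁ c₂ := by
  obtain ⟨Φ, Ψ, h, hW⟩ := hgen
  obtain ⟨c₀, c₁, c₂, hc⟩ := eq_quadratic_of_iteratedDeriv_three (contDiff_velX_slice h)
    (iteratedDeriv_three_velX hn h hW)
  refine ⟨c₀, c₁, c₂, ?_⟩
  ext1 ⟨x, b⟩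
  refine Prod.ext ?_ (funext fun i => ?_)
  · rw [← velX_eq hn h hW x b one_ne_zero]
    exact (hc x).1
  set u : ℝ → ℝ := fun t => monom x 0 t + (-b ⟨0, by omega⟩) * monom x n t with hu
  have hus : ContDiff ℝ ∞ u :=
    (contDiff_monom x 0).add (contDiff_const.mul (contDiff_monom x n))
  have hux : u x ≠ 0 := by
    have : n ≠ 0 := by omega
    simp [hu, monom, this]
  have hL : linOp b u x = 0 := by
    have e1 := linOp_monom b x ⟨0, by omega⟩
    simp only at e1
    rw [hu, linOp_add_smul b (contDiff_monom x 0) (contDiff_monom x n), linOp_monom_self hn, e1]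
    ring
  -- Among the orders below n, only order i of w is nonzero at x, which isolates φ_i; the term of
  -- degree n makes w admissible.
  set w : ℝ → ℝ := fun t => monom x i t + (-b i) * monom x n t with hw
  have hws : ContDiff ℝ ∞ w :=
    (contDiff_monom x i).add (contDiff_const.mul (contDiff_monom x n))
  have hLw : linOp b w x = 0 := by
    rw [hw, linOp_add_smul b (contDiff_monom x i) (contDiff_monom x n), linOp_monom_self hn,
      linOp_monom]
    ring
  have hhs := (contDiff_velYderiv h hus).contDiffAt (x := x)
  have hξs := (contDiff_velX_slice h).contDiffAt (x := x)
  have hq' : ∀ k, 3 ≤ k → iteratedDeriv k (fun t => velX Φ (t, 1)) x = 0 := by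
    intro k hk
    obtain ⟨d, rfl⟩ := Nat.exists_eq_add_of_le hk
    have e : iteratedDeriv 3 (fun t => velX Φ (t, 1)) = fun _ => 0 :=
      funext (iteratedDeriv_three_velX hn h hW)
    rw [add_comm, iteratedDeriv_eq_iterate, Function.iterate_add_apply, ← iteratedDeriv_eq_iterate,
      ← iteratedDeriv_eq_iterate, e]
    simp
  -- The formula for h' is available only where u ≠ 0, hence only near x; this is enough for all
  -- derivatives of h at x.
  have hdev : deriv (velYderiv Φ u) =ᶠ[𝓝 x] fun _ => (n - 1 : ℝ) * c₂ := by
    filter_upwards [(isOpen_ne_fun hus.continuous continuous_const).mem_nhds hux] with t ht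
    rw [deriv_velYderiv hn h hW hus ht, (hc t).2.2]; ring
  have hr' : ∀ k, 2 ≤ k → iteratedDeriv k (velYderiv Φ u) x = 0 := by
    intro k hk
    obtain ⟨d, rfl⟩ := Nat.exists_eq_add_of_le hk
    rw [show 2 + d = d + 1 + 1 by omega, iteratedDeriv_succ', hdev.iteratedDeriv_eq]
    simp [iteratedDeriv_const]
  have hT := lieTerm_monom hhs hξs (hc x).2.1 (hc x).2.2 hq' hdev.eq_of_nhds hr'
  have key := sum_lieTerm_eq_zero hn h hW hus hws hux hL hLw
  have hi := i.2
  have hji : ∀ j : Fin (n - 2), iteratedDeriv (j : ℕ) w x = if j = i then 1 else 0 := by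
    intro j
    have : (j : ℕ) ≠ n := by omega
    rw [hw, iteratedDeriv_add_smul (contDiff_monom x i).contDiffAt (contDiff_monom x n).contDiffAt,
      iteratedDeriv_monom, iteratedDeriv_monom, if_neg this]
    simp [Fin.ext_iff]
  have hlj : ∀ j : Fin (n - 2), lieTerm (velYderiv Φ u) (fun t => velX Φ (t, 1)) w x j
      = (if j = i then velYderiv Φ u x - i * (c₁ + 2 * c₂ * x) else 0)
      + if (j : ℕ) = i + 1 then (i + 1 : ℝ) * ((n - 1) * c₂ - i / 2 * (2 * c₂)) else 0 := by
    intro j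
    have h1 : (j : ℕ) ≠ n := by omega
    have h2 : (j : ℕ) ≠ n + 1 := by omega
    rw [hw, lieTerm_add_smul hhs hξs (contDiff_monom x i) (contDiff_monom x n), hT, hT, if_neg h1,
      if_neg h2]
    simp [Fin.ext_iff]
  have hln : lieTerm (velYderiv Φ u) (fun t => velX Φ (t, 1)) w x n
      = -b i * (velYderiv Φ u x - n * (c₁ + 2 * c₂ * x)) := by
    have h1 : n ≠ (i : ℕ) := by omega
    have h2 : n ≠ (i : ℕ) + 1 := by omega
    rw [hw, lieTerm_add_smul hhs hξs (contDiff_monom x i) (contDiff_monom x n), hT, hT, if_neg h1,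
      if_neg h2]
    simp
  simp only [hji, hlj, hln, mul_add, Finset.sum_add_distrib,
    sum_mul_ite_eq_nextCoeff] at key
  simp only [mul_ite, mul_one, mul_zero, Finset.sum_ite_eq', Finset.mem_univ, if_true] at key
  simp only [quadField]
  -- The unknown value h(x) enters as b_i h(x) from order i and as -b_i h(x) from order n, and
  -- cancels.
  linear_combination key

end Family

/-! ### Realization of the generators by one-parameter families -/

theorem curveDeriv_affine {A : ℝ} (B : ℝ) (u : ℝ → ℝ) (k : ℕ) :
    curveDeriv (fun t => A * t + B) u k = fun t => A⁻¹ ^ k * iteratedDeriv k u t := by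
  induction k with
  | zero => ext; simp [curveDeriv]
  | succ k ih =>
    ext t
    have h : deriv (fun t => A * t + B) t = A := by
      simp
    change deriv (curveDeriv (fun t => A * t + B) u k) t / deriv (fun t => A * t + B) t = _
    rw [h, ih, deriv_const_mul_field, iteratedDeriv_succ, pow_succ]
    ring

/-- With y fixed and the derivation along the new variable equal to e^{-c₁ε} d/dx, multiplying a_j
by e^{-(n-j)c₁ε} gives every term of the equation the common factor e^{-nc₁ε}. -/
theorem isGenerator_affine (n : ℕ) (c₀ c₁ : ℝ) : IsGenerator n (quadField n c₀ c₁ 0) := by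
  refine ⟨fun ε z => (Real.exp (c₁ * ε) * z.1 + c₀ * ε, z.2),
    fun ε z => (Real.exp (c₁ * ε) * z.1 + c₀ * ε,
      fun j => Real.exp (-(c₁ * ε)) ^ (n - (j : ℕ)) * z.2 j),
    ⟨⟨Set.univ, isOpen_univ, fun _ => trivial, ?_⟩, ⟨Set.univ, isOpen_univ, fun _ => trivial, ?_⟩,
      fun z => by simp, fun z => by simp, ?_⟩, fun z => ?_⟩
  · exact ContDiff.contDiffOn (by fun_prop)
  · refine ContDiff.contDiffOn (ContDiff.prodMk (by fun_prop) (contDiff_pi.2 fun j => ?_))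
    fun_prop
  · intro I a u hI _ _ hs x hx
    have : ∀ᶠ q : ℝ × ℝ in 𝓝 ((0 : ℝ), x), q.2 ∈ I :=
      continuous_snd.continuousAt.eventually (hI.mem_nhds hx)
    filter_upwards [this] with q hq
    refine ⟨rfl, ?_⟩
    have := hs q.2 hq
    simp only [curveDeriv_affine, ← Real.exp_neg]
    set r := Real.exp (-(c₁ * q.1))
    have e : ∀ j : Fin (n - 2), r ^ (n - (j : ℕ)) * a q.2 j * (r ^ (j : ℕ) * iteratedDeriv j u q.2)
        = r ^ n * (a q.2 j * iteratedDeriv j u q.2) := fun j => by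
      have : r ^ n = r ^ (n - (j : ℕ)) * r ^ (j : ℕ) := by
        rw [← pow_add]; congr 1; omega
      rw [this]; ring
    simp only [e]
    rw [← Finset.mul_sum, ← mul_add, this, mul_zero]
  · refine HasDerivAt.prodMk ?_ (hasDerivAt_pi.2 fun j => ?_)
    · have h := ((((hasDerivAt_id (0 : ℝ)).const_mul c₁).exp.mul_const z.1).add
        ((hasDerivAt_id (0 : ℝ)).const_mul c₀))
      refine h.congr_deriv ?_
      simp; ring
    · have h := ((((hasDerivAt_id (0 : ℝ)).const_mul c₁).neg.exp.pow (n - (j : ℕ))).mul_const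
        (z.2 j))
      refine h.congr_deriv ?_
      have hj : (j : ℕ) ≤ n := by omega
      simp [Nat.cast_sub hj]

/-- The coefficients that express the derivatives with respect to `x` by those with respect to
`x / (1 - ε x)`. -/
def projCoeff (n k i : ℕ) : ℝ := (k.choose i : ℝ) * ∏ l ∈ Finset.Ico i k, ((n : ℝ) - 1 - l)

theorem projCoeff_of_lt (n : ℕ) {k i : ℕ} (h : k < i) : projCoeff n k i = 0 := by
  simp [projCoeff, Nat.choose_eq_zero_of_lt h]

theorem projCoeff_self (n k : ℕ) : projCoeff n k k = 1 := by simp [projCoeff]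

theorem projCoeff_succ_self (n k : ℕ) : projCoeff n (k + 1) k = (k + 1 : ℝ) * (n - 1 - k) := by
  simp [projCoeff, Nat.choose_succ_self_right]

/-- The factor with l = n-1 vanishes. This is what the weight n-1 of y is for: the n-th derivative
transforms without lower-order terms, so the canonical form is preserved. -/
theorem projCoeff_order {n i : ℕ} (h : i < n) : projCoeff n n i = 0 := by
  rw [projCoeff, Finset.prod_eq_zero (i := n - 1), mul_zero]
  · exact Finset.mem_Ico.2 ⟨by omega, by omega⟩
  · rw [Nat.cast_sub (by omega)]; simp

theorem projCoeff_succ_zero (n k : ℕ) :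
    projCoeff n (k + 1) 0 = (n - 1 - k : ℝ) * projCoeff n k 0 := by
  simp [projCoeff, Finset.prod_range_succ, mul_comm]

theorem projCoeff_succ_succ (n k i : ℕ) : projCoeff n (k + 1) (i + 1)
    = projCoeff n k i + (n - 1 - k - (i + 1) : ℝ) * projCoeff n k (i + 1) := by
  rcases lt_trichotomy k i with h | rfl | h
  · simp [projCoeff_of_lt n h, projCoeff_of_lt n (show k < i + 1 by omega),
      projCoeff_of_lt n (show k + 1 < i + 1 by omega)]
  · simp [projCoeff_self, projCoeff_of_lt]
  · have hc : (k.choose (i + 1) : ℝ) * (i + 1) = k.choose i * (k - i) := by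
      have := Nat.choose_succ_right_eq k i
      have h2 : ((k - i : ℕ) : ℝ) = k - i := Nat.cast_sub h.le
      rw [← h2]
      exact_mod_cast this
    rw [projCoeff, projCoeff, projCoeff, Finset.prod_Ico_succ_top (by omega),
      Finset.prod_eq_prod_Ico_succ_bot h, Nat.choose_succ_succ]
    push_cast
    linear_combination (∏ l ∈ Finset.Ico (i + 1) k, ((n : ℝ) - 1 - l)) * hc

/-- Derivatives of a function expressed by the derivatives along its image under
`(x, y) ↦ (x / (1 - ε x), y / (1 - ε x)^(n-1))`. -/
theorem iteratedDeriv_eq_sum_curveDeriv {n : ℕ} (hn : 1 ≤ n) {ε : ℝ} {u : ℝ → ℝ} {T : Set ℝ}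
    (hT : IsOpen T) (hu : ContDiffOn ℝ ∞ u T) (hpos : ∀ t ∈ T, 0 < 1 - ε * t) (k : ℕ) :
    ∀ t ∈ T, iteratedDeriv k u t = ∑ i ∈ Finset.range (k + 1),
      projCoeff n k i * (-ε) ^ (k - i) * (1 - ε * t) ^ ((n : ℤ) - 1 - k - i) *
        curveDeriv (fun t => t / (1 - ε * t)) (fun t => u t / (1 - ε * t) ^ (n - 1)) i t := by
  set X : ℝ → ℝ := fun t => t / (1 - ε * t)
  set Y : ℕ → ℝ → ℝ := curveDeriv X (fun t => u t / (1 - ε * t) ^ (n - 1)) with hY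
  have hs : ∀ t, HasDerivAt (fun t => 1 - ε * t) (-ε) t := fun t => by
    simpa using ((hasDerivAt_id t).const_mul ε).const_sub 1
  have hX : ∀ t ∈ T, deriv X t = (1 - ε * t) ^ (-2 : ℤ) := fun t ht => by
    have := ((hasDerivAt_id t).div (hs t) (hpos t ht).ne')
    refine this.deriv.trans ?_
    have h0 := (hpos t ht).ne'
    rw [zpow_neg]
    simp only [id]
    norm_cast
    field_simp
    ring
  have hXs : ∀ t ∈ T, ContDiffAt ℝ ∞ X t := fun t ht =>
    contDiffAt_id.div (by fun_prop) (hpos t ht).ne'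
  have hYs : ∀ i, ∀ t ∈ T, ContDiffAt ℝ ∞ (Y i) t := by
    intro i
    induction i with
    | zero =>
      intro t ht
      exact (hu.contDiffAt (hT.mem_nhds ht)).div (by fun_prop) (pow_ne_zero _ (hpos t ht).ne')
    | succ i ih =>
      intro t ht
      refine (contDiffAt_deriv (ih t ht)).div (contDiffAt_deriv (hXs t ht)) ?_
      rw [hX t ht]
      exact zpow_ne_zero _ (hpos t ht).ne'
  have hYd : ∀ i, ∀ t ∈ T, HasDerivAt (Y i) (Y (i + 1) t * (1 - ε * t) ^ (-2 : ℤ)) t := by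
    intro i t ht
    have h := ((hYs i t ht).differentiableAt (by simp)).hasDerivAt
    have e : Y (i + 1) t = deriv (Y i) t / deriv X t := rfl
    rw [e, hX t ht, div_mul_cancel₀ _ (zpow_ne_zero _ (hpos t ht).ne')]
    exact h
  induction k with
  | zero =>
    intro t ht
    have h0 := (hpos t ht).ne'
    have e : Y 0 t = u t / (1 - ε * t) ^ (n - 1) := rfl
    rw [Finset.sum_range_one, e, projCoeff_self,
      show (n : ℤ) - 1 - (0 : ℕ) - (0 : ℕ) = ((n - 1 : ℕ) : ℤ) by push_cast [hn]; ring, zpow_natCast]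
    simp only [iteratedDeriv_zero]
    field_simp
    simp
  | succ k ih =>
    intro t ht
    have h0 := (hpos t ht).ne'
    have hev : iteratedDeriv k u =ᶠ[𝓝 t] fun t => ∑ i ∈ Finset.range (k + 1),
        projCoeff n k i * (-ε) ^ (k - i) * (1 - ε * t) ^ ((n : ℤ) - 1 - k - i) * Y i t := by
      filter_upwards [hT.mem_nhds ht] with t' ht'
      exact ih t' ht'
    rw [iteratedDeriv_succ, hev.deriv_eq]
    have hterm : ∀ i ∈ Finset.range (k + 1), HasDerivAt (fun t => projCoeff n k i * (-ε) ^ (k - i)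
        * (1 - ε * t) ^ ((n : ℤ) - 1 - k - i) * Y i t)
        (projCoeff n k i * ((n : ℝ) - 1 - k - i) * ((-ε) ^ (k + 1 - i)
          * (1 - ε * t) ^ ((n : ℤ) - 1 - (k + 1 : ℕ) - i) * Y i t)
        + projCoeff n k i * ((-ε) ^ (k + 1 - (i + 1)) *
          (1 - ε * t) ^ ((n : ℤ) - 1 - (k + 1 : ℕ) - (i + 1 : ℕ)) * Y (i + 1) t)) t := by
      intro i hi
      have hik : i ≤ k := Nat.lt_succ_iff.1 (Finset.mem_range.1 hi)
      have hz : HasDerivAt (fun t => (1 - ε * t) ^ ((n : ℤ) - 1 - k - i))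
          (((n : ℤ) - 1 - k - i : ℤ) * (1 - ε * t) ^ ((n : ℤ) - 1 - k - i - 1) * (-ε)) t :=
        HasDerivAt.comp (h₂ := fun y => y ^ ((n : ℤ) - 1 - k - i)) t
          (hasDerivAt_zpow _ _ (Or.inl h0)) (hs t)
      refine ((hz.const_mul (projCoeff n k i * (-ε) ^ (k - i))).mul (hYd i t ht)).congr_deriv ?_
      rw [show k + 1 - i = (k - i) + 1 by omega, Nat.add_sub_add_right,
        show (n : ℤ) - 1 - (k + 1 : ℕ) - i = (n : ℤ) - 1 - k - i - 1 by push_cast; ring,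
        show (n : ℤ) - 1 - (k + 1 : ℕ) - (i + 1 : ℕ) = ((n : ℤ) - 1 - k - i) + (-2) by
          push_cast; ring, zpow_add₀ h0 _ (-2), pow_succ]
      push_cast
      ring
    rw [(HasDerivAt.fun_sum hterm).deriv, Finset.sum_add_distrib, Finset.sum_range_succ' _ (k + 1)]
    have hext : ∀ f : ℕ → ℝ, ∑ i ∈ Finset.range (k + 1), projCoeff n k i * f i
        = ∑ i ∈ Finset.range (k + 1), projCoeff n k (i + 1) * f (i + 1) + projCoeff n k 0 * f 0 := by
      intro f
      have := Finset.sum_range_succ (fun i => projCoeff n k i * f i) (k + 1)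
      rw [projCoeff_of_lt n (Nat.lt_succ_self k), zero_mul, add_zero] at this
      rw [← this, Finset.sum_range_succ']
    simp only [mul_assoc (projCoeff n k _)]
    rw [hext, add_right_comm, ← Finset.sum_add_distrib]
    congr 1
    · refine Finset.sum_congr rfl fun i _ => ?_
      rw [projCoeff_succ_succ]
      push_cast
      ring
    · rw [projCoeff_succ_zero]
      push_cast
      ring

theorem hasDerivAt_pow_mul_pow (x : ℝ) (d m : ℕ) :
    HasDerivAt (fun ε : ℝ => (-ε) ^ d * (1 - ε * x) ^ m)
      (if d = 0 then -(m * x) else if d = 1 then -1 else 0) 0 := by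
  have h1 : HasDerivAt (fun ε : ℝ => (-ε) ^ d) (d * (-0) ^ (d - 1) * (-1)) 0 :=
    (hasDerivAt_neg (0 : ℝ)).pow d
  have h2 : HasDerivAt (fun ε : ℝ => (1 - ε * x) ^ m) (m * (1 - 0 * x) ^ (m - 1) * (-x)) 0 := by
    have : HasDerivAt (fun ε : ℝ => 1 - ε * x) (-x) 0 := by
      simpa using ((hasDerivAt_id (0 : ℝ)).mul_const x).const_sub 1
    exact this.pow m
  refine (h1.mul h2).congr_deriv ?_
  rcases d with _ | _ | d
  · simp
  · simp
  · simp

/-- With s = 1 - εx, the equation in the new variables is s^(n+1) times the old one. Its n-th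
derivative becomes the new one alone, and collecting the lower derivatives gives the new
coefficients, polynomial in ε and x. To first order in ε only the entries j = i and j = i+1 survive.
-/
theorem isGenerator_projective {n : ℕ} (hn : 3 ≤ n) : IsGenerator n (quadField n 0 0 1) := by
  refine ⟨fun ε z => (z.1 / (1 - ε * z.1), z.2 / (1 - ε * z.1) ^ (n - 1)),
    fun ε z => (z.1 / (1 - ε * z.1), fun i => ∑ j : Fin (n - 2),
      projCoeff n j i * ((-ε) ^ ((j : ℕ) - i) * (1 - ε * z.1) ^ (2 * n - i - j)) * z.2 j),
    ⟨⟨{q | 0 < 1 - q.1 * q.2.1}, isOpen_lt (by fun_prop) (by fun_prop), fun _ => by simp, ?_⟩,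
      ⟨{q | 0 < 1 - q.1 * q.2.1}, isOpen_lt (by fun_prop) (by fun_prop), fun _ => by simp, ?_⟩,
      fun z => by simp, fun z => ?_, ?_⟩, fun z => ?_⟩
  · refine ContDiffOn.prodMk (ContDiffOn.div (by fun_prop) (by fun_prop) fun q hq => hq.ne')
      (ContDiffOn.div (by fun_prop) (by fun_prop) fun q hq => pow_ne_zero _ (ne_of_gt hq))
  · refine ContDiffOn.prodMk (ContDiffOn.div (by fun_prop) (by fun_prop) fun q hq => hq.ne')
      (contDiffOn_pi.2 fun i => ContDiff.contDiffOn ?_)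
    fun_prop
  · refine Prod.ext (by simp) (funext fun i => ?_)
    simp only
    rw [Finset.sum_eq_single i]
    · simp [projCoeff_self]
    · intro j _ hj
      rcases lt_or_ge (j : ℕ) i with h | h
      · rw [projCoeff_of_lt n h]; simp
      · have : (j : ℕ) - i ≠ 0 := by
          have : (j : ℕ) ≠ i := fun e => hj (Fin.ext e)
          omega
        simp [this]
    · simp
  · intro I a u hI _ hu hs x hx
    have h1 : ∀ᶠ q : ℝ × ℝ in 𝓝 ((0 : ℝ), x), q.2 ∈ I :=
      continuous_snd.continuousAt.eventually (hI.mem_nhds hx)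
    have h2 : ∀ᶠ q : ℝ × ℝ in 𝓝 ((0 : ℝ), x), 0 < 1 - q.1 * q.2 := by
      have hO : IsOpen {q : ℝ × ℝ | 0 < 1 - q.1 * q.2} := isOpen_lt (by fun_prop) (by fun_prop)
      exact hO.mem_nhds (by simp)
    filter_upwards [h1, h2] with q hq1 hq2
    refine ⟨rfl, ?_⟩
    obtain ⟨ε, t⟩ := q
    simp only at hq1 hq2 ⊢
    have hT : IsOpen (I ∩ {t | 0 < 1 - ε * t}) :=
      hI.inter (isOpen_lt (by fun_prop) (by fun_prop))
    have key := fun k => iteratedDeriv_eq_sum_curveDeriv (n := n) (by omega) (ε := ε) hT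
      (hu.mono Set.inter_subset_left) (fun t ht => ht.2) k t ⟨hq1, hq2⟩
    set Y := curveDeriv (fun t => t / (1 - ε * t)) (fun t => u t / (1 - ε * t) ^ (n - 1))
    have heq := hs t hq1
    have h0 : (1 - ε * t) ≠ 0 := hq2.ne'
    -- The expansion of the n-th derivative has leading power -(n+1), so this factor makes the
    -- transformed equation monic.
    have hnn : (1 - ε * t) ^ (n + 1) * iteratedDeriv n u t = Y n t := by
      rw [key, Finset.sum_range_succ, Finset.sum_eq_zero, zero_add, projCoeff_self]
      · rw [show (n : ℤ) - 1 - n - n = -((n + 1 : ℕ) : ℤ) by push_cast; ring, zpow_neg, zpow_natCast]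
        field_simp
        simp
      · intro i hi
        rw [projCoeff_order (Finset.mem_range.1 hi)]; simp
    have hj : ∀ j : Fin (n - 2), (1 - ε * t) ^ (n + 1) * iteratedDeriv (j : ℕ) u t
        = ∑ i : Fin (n - 2), projCoeff n j i *
          ((-ε) ^ ((j : ℕ) - i) * (1 - ε * t) ^ (2 * n - i - j)) * Y i t := by
      intro j
      rw [key, Finset.mul_sum, Fin.sum_univ_eq_sum_range (fun i => projCoeff n j i *
          ((-ε) ^ ((j : ℕ) - i) * (1 - ε * t) ^ (2 * n - i - j)) * Y i t) (n - 2)]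
      have hj2 := j.2
      rw [← Finset.sum_subset (Finset.range_subset_range.2 (show (j : ℕ) + 1 ≤ n - 2 by omega))]
      · refine Finset.sum_congr rfl fun i hi => ?_
        have hi' := Finset.mem_range.1 hi
        have : (1 - ε * t) ^ (2 * n - i - j)
            = (1 - ε * t) ^ (n + 1) * (1 - ε * t) ^ ((n : ℤ) - 1 - (j : ℕ) - i) := by
          -- The exponents add up: (n+1) + (n-1-j-i) = 2n-i-j, nonnegative since i, j ≤ n-3.
          rw [← zpow_natCast, ← zpow_natCast, ← zpow_add₀ h0]
          congr 1
          omega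
        rw [this]
        ring
      · intro i _ hi
        rw [projCoeff_of_lt n (by simpa using hi)]; simp
    have : (1 - ε * t) ^ (n + 1) * (iteratedDeriv n u t
        + ∑ j : Fin (n - 2), a t j * iteratedDeriv (j : ℕ) u t) = 0 := by rw [heq, mul_zero]
    rw [← this, mul_add, hnn, Finset.mul_sum]
    congr 1
    simp only [mul_left_comm _ (a t _), hj]
    simp only [Finset.sum_mul, Finset.mul_sum]
    rw [Finset.sum_comm]
    exact Finset.sum_congr rfl fun j _ => Finset.sum_congr rfl fun i _ => by ring
  · refine HasDerivAt.prodMk ?_ (hasDerivAt_pi.2 fun i => ?_)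
    · have h : HasDerivAt (fun ε : ℝ => 1 - ε * z.1) (-z.1) 0 := by
        simpa using ((hasDerivAt_id (0 : ℝ)).mul_const z.1).const_sub 1
      refine ((hasDerivAt_const (0 : ℝ) z.1).div h (by simp)).congr_deriv ?_
      simp; ring
    · refine (HasDerivAt.fun_sum (u := Finset.univ) fun (j : Fin (n - 2)) _ =>
        ((hasDerivAt_pow_mul_pow z.1 ((j : ℕ) - i) (2 * n - i - j)).const_mul
          (projCoeff n j i)).mul_const (z.2 j)).congr_deriv ?_
      have hi := i.2
      have e : ∀ j : Fin (n - 2), projCoeff n j i * (if (j : ℕ) - i = 0 then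
          -(((2 * n - i - j : ℕ) : ℝ) * z.1) else if (j : ℕ) - i = 1 then -1 else 0) * z.2 j
          = (if j = i then -(2 * (n - i : ℝ) * z.1) * z.2 i else 0)
            + z.2 j * if (j : ℕ) = i + 1 then -((i + 1 : ℝ) * (n - 1 - i)) else 0 := by
        intro j
        rcases lt_trichotomy (j : ℕ) i with h | h | h
        · have h' : j ≠ i := fun e => by simp [e] at h
          rw [projCoeff_of_lt n h, if_neg h', if_neg (show ¬(j : ℕ) = i + 1 by omega)]
          simp
        · have h' : j = i := Fin.ext h
          subst h'
          rw [projCoeff_self, if_pos (by omega), if_pos rfl, if_neg (by omega),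
            show 2 * n - (j : ℕ) - j = 2 * (n - j) by omega, Nat.cast_mul, Nat.cast_sub (by omega)]
          push_cast
          ring
        · have h' : j ≠ i := fun e => by simp [e] at h
          rw [if_neg h', if_neg (show ¬(j : ℕ) - i = 0 by omega)]
          by_cases h1 : (j : ℕ) = i + 1
          · rw [if_pos (by omega), if_pos h1, h1, projCoeff_succ_self]; ring
          · rw [if_neg (by omega), if_neg h1]; simp
      rw [Finset.sum_congr rfl fun j _ => e j, Finset.sum_add_distrib, Finset.sum_ite_eq',
        if_pos (Finset.mem_univ _)]
      rw [sum_mul_ite_eq_nextCoeff]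
      ring

/-! ### Prolongation of the generators -/

/-- The linear vector field on the fibres of the jet space that is the prolongation of the generator
with `ξ = x` at `x = 0`. -/
def scaleField {n p : ℕ} (b : Fin (p + 1) → Coeff n) : Fin (p + 1) → Coeff n :=
  fun k j => -(n - j + k : ℝ) * b k j

/-- The linear vector field on the fibres of the jet space that is the prolongation of the generator
with `ξ = x²` at `x = 0`. -/
def shiftField {n p : ℕ} (b : Fin (p + 1) → Coeff n) : Fin (p + 1) → Coeff n :=
  fun k j => -((k : ℝ) * (2 * (n - j) + (k - 1))) * b ⟨k - 1, by omega⟩ j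
    - (j + 1 : ℝ) * (n - 1 - j) * nextCoeff (b k) j

theorem iteratedDeriv_apply {m : ℕ} {g : ℝ → Fin m → ℝ} (hg : ContDiff ℝ ∞ g) (k : ℕ) (t : ℝ)
    (j : Fin m) : iteratedDeriv k g t j = iteratedDeriv k (fun s => g s j) t := by
  induction k generalizing g with
  | zero => simp
  | succ k ih =>
    have h1 : ContDiff ℝ ∞ (deriv g) :=
      contDiff_iff_contDiffAt.2 fun t => contDiffAt_deriv hg.contDiffAt
    rw [iteratedDeriv_succ', ih h1, iteratedDeriv_succ']
    congr 1
    ext s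
    exact (hasDerivAt_pi.1 ((hg.differentiable (by simp) s).hasDerivAt) j).deriv.symm

section Taylor

variable {n p : ℕ} (z : Jet n p)

theorem taylorRep_apply (t : ℝ) (j : Fin (n - 2)) :
    taylorRep z t j = ∑ k : Fin (p + 1), monom z.1 k t * z.2 k j := by
  simp [taylorRep, monom]

theorem contDiff_taylorRep : ContDiff ℝ ∞ (taylorRep z) := by
  unfold taylorRep
  fun_prop

theorem iteratedDeriv_taylorRep_apply (m : ℕ) (j : Fin (n - 2)) :
    iteratedDeriv m (fun t => taylorRep z t j) z.1
      = if h : m < p + 1 then z.2 ⟨m, h⟩ j else 0 := by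
  have h1 : ∀ k : Fin (p + 1), ContDiffAt ℝ m (fun t => monom z.1 k t * z.2 k j) z.1 := fun k =>
    ((contDiff_monom z.1 k).of_le (by exact_mod_cast le_top)).contDiffAt.mul contDiffAt_const
  simp only [taylorRep_apply]
  rw [iteratedDeriv_fun_sum fun k _ => h1 k]
  simp only [iteratedDeriv_mul_const_field, iteratedDeriv_monom, ite_mul, one_mul, zero_mul]
  split_ifs with h
  · rw [Finset.sum_eq_single ⟨m, h⟩]
    · simp
    · intro k _ hk
      rw [if_neg fun e => hk (Fin.ext e.symm)]
    · simp
  · exact Finset.sum_eq_zero fun k _ => if_neg (by omega)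

theorem iteratedDeriv_taylorRep_apply_fin (k : Fin (p + 1)) (j : Fin (n - 2)) :
    iteratedDeriv k (fun t => taylorRep z t j) z.1 = z.2 k j := by
  rw [iteratedDeriv_taylorRep_apply, dif_pos k.2]

theorem contDiff_nextCoeff_taylorRep (j : Fin (n - 2)) :
    ContDiff ℝ ∞ fun t => nextCoeff (taylorRep z t) j := by
  unfold nextCoeff
  split_ifs with h
  · exact contDiff_pi.1 (contDiff_taylorRep z) _
  · exact contDiff_const

theorem iteratedDeriv_nextCoeff_taylorRep (k : Fin (p + 1)) (j : Fin (n - 2)) :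
    iteratedDeriv k (fun t => nextCoeff (taylorRep z t) j) z.1 = nextCoeff (z.2 k) j := by
  unfold nextCoeff
  split_ifs with h
  · exact iteratedDeriv_taylorRep_apply_fin z k _
  · simp

theorem contDiff_quadField (c₀ c₁ c₂ : ℝ) : ContDiff ℝ ∞ (quadField n c₀ c₁ c₂) := by
  refine ContDiff.prodMk (by fun_prop) (contDiff_pi.2 fun j => ?_)
  have : ContDiff ℝ ∞ fun z : Base n => nextCoeff z.2 j := by
    unfold nextCoeff
    split_ifs with h
    · fun_prop
    · exact contDiff_const
  fun_prop

/-- Expanding ξ about the base point x leaves ξ(x), ξ'(x) = c₁ + 2c₂x and c₂ as coefficients. The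
contribution of ξ(x) to the fibre components is the cancelling pair ∓ξ a^(k+1), so only scaling and
shift remain there. -/
theorem prolong_quadField (c₀ c₁ c₂ : ℝ) :
    prolong (quadField n c₀ c₁ c₂) z = (c₀ + c₁ * z.1 + c₂ * z.1 ^ 2,
      (c₁ + 2 * c₂ * z.1) • scaleField z.2 + c₂ • shiftField z.2) := by
  refine Prod.ext rfl (funext fun k => funext fun j => ?_)
  have ha := contDiff_taylorRep z
  have hda : ContDiff ℝ ∞ (deriv (taylorRep z)) :=
    contDiff_iff_contDiffAt.2 fun t => contDiffAt_deriv ha.contDiffAt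
  have hW : ContDiff ℝ ∞ fun s => quadField n c₀ c₁ c₂ (s, taylorRep z s) :=
    (contDiff_quadField c₀ c₁ c₂).comp (contDiff_id.prodMk ha)
  set x := z.1 with hx
  set f : ℝ → ℝ := fun t => taylorRep z t j with hf
  set g : ℝ → ℝ := fun t => nextCoeff (taylorRep z t) j with hg
  have hfs : ContDiff ℝ ∞ f := contDiff_pi.1 ha j
  have hdfs : ContDiff ℝ ∞ (deriv f) :=
    contDiff_iff_contDiffAt.2 fun t => contDiffAt_deriv hfs.contDiffAt
  have hgs : ContDiff ℝ ∞ g := contDiff_nextCoeff_taylorRep z j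
  have hd : ∀ s, deriv (taylorRep z) s j = deriv f s := fun s => by
    simpa using iteratedDeriv_apply ha 1 s j
  -- The j-th component of φ - ξ a' as a combination of products with powers of s - x, to which the
  -- Leibniz rule at x applies termwise. `monom x 2` carries 1/2!, hence the coefficient 2c₂.
  have e : (fun s => ((quadField n c₀ c₁ c₂ (s, taylorRep z s)).2
      - (quadField n c₀ c₁ c₂ (s, taylorRep z s)).1 • deriv (taylorRep z) s) j)
      = fun s => ((((((0 : ℝ) + (-(n - j : ℝ) * (c₁ + 2 * c₂ * x)) * f s)
        + (-(n - j : ℝ) * (2 * c₂)) * (f s * monom x 1 s))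
        + (-((j + 1 : ℝ) * (n - 1 - j) * c₂)) * g s)
        + (-(c₀ + c₁ * x + c₂ * x ^ 2)) * deriv f s)
        + (-(c₁ + 2 * c₂ * x)) * (deriv f s * monom x 1 s))
        + (-(2 * c₂)) * (deriv f s * monom x 2 s) := by
    ext s
    simp only [quadField, Pi.sub_apply, Pi.smul_apply, smul_eq_mul, hd, hf, hg, monom]
    norm_num [Nat.factorial]
    ring
  have hm : ∀ i, ContDiff ℝ ∞ (monom x i) := contDiff_monom x
  change prolongCoeff (quadField n c₀ c₁ c₂) (taylorRep z) k x j = _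
  have hV : ContDiff ℝ ∞ fun s => (quadField n c₀ c₁ c₂ (s, taylorRep z s)).2
      - (quadField n c₀ c₁ c₂ (s, taylorRep z s)).1 • deriv (taylorRep z) s :=
    hW.snd.sub (hW.fst.smul hda)
  rw [prolongCoeff, Pi.add_apply, iteratedDeriv_apply hV, e]
  rw [iteratedDeriv_add_smul, iteratedDeriv_add_smul, iteratedDeriv_add_smul,
    iteratedDeriv_add_smul, iteratedDeriv_add_smul, iteratedDeriv_add_smul,
    iteratedDeriv_mul_monom hfs.contDiffAt, iteratedDeriv_mul_monom hdfs.contDiffAt,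
    iteratedDeriv_mul_monom hdfs.contDiffAt]
  · have e1 : iteratedDeriv k g x = nextCoeff (z.2 k) j := iteratedDeriv_nextCoeff_taylorRep z k j
    have e2 : iteratedDeriv k f x = z.2 k j := iteratedDeriv_taylorRep_apply_fin z k j
    have e3 : ((k : ℕ).choose 1 : ℝ) * iteratedDeriv (k - 1) f x
        = k * z.2 ⟨k - 1, by omega⟩ j := by
      rw [Nat.choose_one_right]
      congr 1
      exact iteratedDeriv_taylorRep_apply_fin z ⟨k - 1, by omega⟩ j
    have e4 : ((k : ℕ).choose 1 : ℝ) * iteratedDeriv (k - 1) (deriv f) x = k * z.2 k j := by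
      rw [Nat.choose_one_right, ← e2]
      obtain ⟨k, hk⟩ := k
      rcases k with _ | k
      · simp
      · simp [iteratedDeriv_succ']
    have e5 : ((k : ℕ).choose 2 : ℝ) * iteratedDeriv (k - 2) (deriv f) x
        = k * (k - 1) / 2 * z.2 ⟨k - 1, by omega⟩ j := by
      rw [Nat.cast_choose_two,
        ← show iteratedDeriv (k - 1) f x = z.2 ⟨k - 1, by omega⟩ j from
          iteratedDeriv_taylorRep_apply_fin z ⟨k - 1, by omega⟩ j]
      obtain ⟨k, hk⟩ := k
      rcases k with _ | _ | k
      · simp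
      · simp
      · simp [iteratedDeriv_succ']
    have e6 : (iteratedDeriv (k + 1) (taylorRep z) x) j = iteratedDeriv k (deriv f) x := by
      rw [iteratedDeriv_apply ha, iteratedDeriv_succ']
    have e7 : iteratedDeriv (k : ℕ) (fun _ : ℝ => (0 : ℝ)) x = 0 := by
      simp
    rw [e1, e2, e3, e4, e5, e7]
    simp only [Pi.smul_apply, smul_eq_mul, Pi.add_apply, e6, quadField, scaleField, shiftField]
    ring
  all_goals exact ContDiff.contDiffAt (by fun_prop)

end Taylor

/-- The prolongations for ξ = 1, x, x² are related to ∂_x, scaling and shift by a triangular matrix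
with ones on the diagonal, so both triples annihilate the same functions. -/
theorem isInvariantOn_iff {n p : ℕ} (hn : 3 ≤ n) {U : Set (Jet n p)} {F : Jet n p → ℝ} :
    IsInvariantOn U F ↔ ContDiffOn ℝ ∞ F U ∧ ∀ z ∈ U,
      fderiv ℝ F z (1, 0) = 0 ∧ fderiv ℝ F z (0, scaleField z.2) = 0 ∧
        fderiv ℝ F z (0, shiftField z.2) = 0 := by
  have hlin : ∀ (L : Jet n p →L[ℝ] ℝ) (r s t : ℝ) (v w : Fin (p + 1) → Coeff n),
      L (r, s • v + t • w) = r * L (1, 0) + s * L (0, v) + t * L (0, w) := by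
    intro L r s t v w
    have : ((r, s • v + t • w) : Jet n p)
        = r • ((1, 0) : Jet n p) + s • ((0, v) : Jet n p) + t • ((0, w) : Jet n p) := by
      ext <;> simp
    rw [this, map_add, map_add, map_smul, map_smul, map_smul]
    simp only [smul_eq_mul]
  refine and_congr_right fun _ => ⟨fun h z hz => ?_, fun h W hW z hz => ?_⟩
  · have h0 := h _ (isGenerator_affine n 1 0) z hz
    have h1 := h _ (isGenerator_affine n 0 1) z hz
    have h2 := h _ (isGenerator_projective hn) z hz
    rw [prolong_quadField, hlin] at h0 h1 h2
    simp only [mul_zero, zero_mul, add_zero, one_mul, zero_add, mul_one] at h0 h1 h2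
    rw [h0] at h1 h2
    simp only [mul_zero, zero_add] at h1 h2
    rw [h1] at h2
    exact ⟨h0, h1, by simpa using h2⟩
  · obtain ⟨c₀, c₁, c₂, rfl⟩ := eq_quadField hn hW
    obtain ⟨h0, h1, h2⟩ := h z hz
    rw [prolong_quadField, hlin, h0, h1, h2]
    simp

/-! ### Flows of scaling and shift, and the orbit map -/

theorem nextCoeff_add {n : ℕ} (b c : Coeff n) (j : Fin (n - 2)) :
    nextCoeff (b + c) j = nextCoeff b j + nextCoeff c j := by
  unfold nextCoeff; split_ifs <;> simp

theorem nextCoeff_smul {n : ℕ} (r : ℝ) (b : Coeff n) (j : Fin (n - 2)) :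
    nextCoeff (r • b) j = r * nextCoeff b j := by
  unfold nextCoeff; split_ifs <;> simp

/-- `shiftField` as a continuous linear map. -/
def shiftCLM (n p : ℕ) : (Fin (p + 1) → Coeff n) →L[ℝ] (Fin (p + 1) → Coeff n) :=
  LinearMap.toContinuousLinearMap
    { toFun := shiftField
      map_add' := fun b c => by
        ext k j; simp only [shiftField, Pi.add_apply, nextCoeff_add]; ring
      map_smul' := fun r b => by
        ext k j
        simp only [shiftField, Pi.smul_apply, nextCoeff_smul, smul_eq_mul, RingHom.id_apply]
        ring }

/-- The flow of `shiftField`. -/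
def shiftFlow {n p : ℕ} (s : ℝ) (b : Fin (p + 1) → Coeff n) : Fin (p + 1) → Coeff n :=
  NormedSpace.exp (s • shiftCLM n p) b

/-- The flow of `scaleField`. -/
def scaleFlow {n p : ℕ} (r : ℝ) (b : Fin (p + 1) → Coeff n) : Fin (p + 1) → Coeff n :=
  fun k j => Real.exp (-(n - j + k : ℝ) * r) * b k j

section Flow

variable {n p : ℕ}

theorem contDiff_shiftFlow :
    ContDiff ℝ ∞ fun q : ℝ × (Fin (p + 1) → Coeff n) => shiftFlow q.1 q.2 := by
  have h : ContDiff ℝ ∞ (NormedSpace.exp :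
      ((Fin (p + 1) → Coeff n) →L[ℝ] (Fin (p + 1) → Coeff n)) → _) :=
    contDiff_iff_contDiffAt.2 fun x => (NormedSpace.exp_analytic (𝕂 := ℝ) x).contDiffAt
  exact (h.comp (contDiff_fst.smul contDiff_const)).clm_apply contDiff_snd

theorem contDiff_scaleFlow :
    ContDiff ℝ ∞ fun q : ℝ × (Fin (p + 1) → Coeff n) => scaleFlow q.1 q.2 := by
  unfold scaleFlow
  fun_prop

theorem shiftFlow_zero (b : Fin (p + 1) → Coeff n) : shiftFlow 0 b = b := by
  simp [shiftFlow]

theorem shiftFlow_add (s t : ℝ) (b : Fin (p + 1) → Coeff n) :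
    shiftFlow (s + t) b = shiftFlow s (shiftFlow t b) := by
  have hc : Commute (s • shiftCLM n p) (t • shiftCLM n p) :=
    ((Commute.refl (shiftCLM n p)).smul_left s).smul_right t
  let _ : NormedAlgebra ℚ ((Fin (p + 1) → Coeff n) →L[ℝ] (Fin (p + 1) → Coeff n)) :=
    NormedAlgebra.restrictScalars ℚ ℝ _
  rw [shiftFlow, add_smul, NormedSpace.exp_add_of_commute hc]
  rfl

theorem scaleFlow_add (s t : ℝ) (b : Fin (p + 1) → Coeff n) :
    scaleFlow (s + t) b = scaleFlow s (scaleFlow t b) := by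
  ext k j
  simp only [scaleFlow]
  rw [mul_add, Real.exp_add]; ring

theorem scaleFlow_zero (b : Fin (p + 1) → Coeff n) : scaleFlow 0 b = b := by
  ext k j; simp [scaleFlow]

theorem hasDerivAt_shiftFlow (b : Fin (p + 1) → Coeff n) (s : ℝ) :
    HasDerivAt (fun s => shiftFlow s b) (shiftField (shiftFlow s b)) s := by
  have h := hasDerivAt_exp_smul_const' (shiftCLM n p) s
  exact (((ContinuousLinearMap.apply ℝ (Fin (p + 1) → Coeff n)) b).hasFDerivAt).comp_hasDerivAt s h

theorem hasDerivAt_scaleFlow (b : Fin (p + 1) → Coeff n) (r : ℝ) :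
    HasDerivAt (fun r => scaleFlow r b) (scaleField (scaleFlow r b)) r := by
  refine hasDerivAt_pi.2 fun k => hasDerivAt_pi.2 fun j => ?_
  refine (((hasDerivAt_id r).const_mul (-(n - j + k : ℝ))).exp.mul_const (b k j)).congr_deriv ?_
  simp only [scaleField, scaleFlow, id]
  ring

/-- The entry (k, j) has weight n - j + k under scaling, and the shift feeds into it only (k-1, j)
and (k, j+1), both of weight one less. -/
theorem scaleFlow_shiftField (r : ℝ) (b : Fin (p + 1) → Coeff n) :
    scaleFlow r (shiftField b) = Real.exp (-r) • shiftField (scaleFlow r b) := by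
  ext k j
  simp only [scaleFlow, shiftField, Pi.smul_apply, smul_eq_mul, mul_sub]
  have hnext : Real.exp (-(n - j + k : ℝ) * r) * nextCoeff (b k) j = Real.exp (-r) *
      nextCoeff (fun j : Fin (n - 2) => Real.exp (-(n - j + k : ℝ) * r) * b k j) j := by
    unfold nextCoeff
    split_ifs with h
    · rw [← mul_assoc, ← Real.exp_add]
      congr 2
      push_cast
      ring
    · simp
  congr 1
  · obtain ⟨k, hk⟩ := k
    -- At k = 0 the truncated index k - 1 is harmless, because the factor k vanishes.
    rcases k with _ | k
    · simp
    · have : Real.exp (-(n - j + (k + 1 : ℕ) : ℝ) * r)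
          = Real.exp (-r) * Real.exp (-(n - j + k : ℝ) * r) := by
        rw [← Real.exp_add]; congr 1; push_cast; ring
      simp only [this, Nat.add_sub_cancel]
      ring
  · change _ = _ * (_ * nextCoeff (fun j : Fin (n - 2) =>
      Real.exp (-(n - j + k : ℝ) * r) * b k j) j)
    linear_combination ((j + 1 : ℝ) * (n - 1 - j)) * hnext

/-- The map that moves the points of a cross-section along the orbits. -/
def orbitMap {m : ℕ} (σ : (Fin m → ℝ) → Fin (p + 1) → Coeff n)
    (q : (ℝ × ℝ × ℝ) × (Fin m → ℝ)) : Jet n p :=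
  (q.1.1, scaleFlow q.1.2.1 (shiftFlow q.1.2.2 (σ q.2)))

variable {m : ℕ} {σ : (Fin m → ℝ) → Fin (p + 1) → Coeff n}

theorem contDiff_orbitMap (hσ : ContDiff ℝ ∞ σ) : ContDiff ℝ ∞ (orbitMap σ) := by
  refine ContDiff.prodMk (by fun_prop) ?_
  have h2 : ContDiff ℝ ∞ fun q : (ℝ × ℝ × ℝ) × (Fin m → ℝ) => shiftFlow q.1.2.2 (σ q.2) :=
    contDiff_shiftFlow.comp ((by fun_prop : ContDiff ℝ ∞
      fun q : (ℝ × ℝ × ℝ) × (Fin m → ℝ) => q.1.2.2).prodMk (hσ.comp contDiff_snd))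
  exact contDiff_scaleFlow.comp ((by fun_prop : ContDiff ℝ ∞
      fun q : (ℝ × ℝ × ℝ) × (Fin m → ℝ) => q.1.2.1).prodMk h2)

/-- Scaling is applied last, so its parameter moves the point along the scaling field; a change of
the shift parameter must pass through the scaling, which produces e^{-r}. -/
theorem fderiv_orbitMap (hσ : ContDiff ℝ ∞ σ) (q : (ℝ × ℝ × ℝ) × (Fin m → ℝ)) :
    fderiv ℝ (orbitMap σ) q ((1, 0, 0), 0) = (1, 0) ∧
    fderiv ℝ (orbitMap σ) q ((0, 1, 0), 0) = (0, scaleField (orbitMap σ q).2) ∧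
    fderiv ℝ (orbitMap σ) q ((0, 0, 1), 0)
      = (0, Real.exp (-q.1.2.1) • shiftField (orbitMap σ q).2) := by
  have hcomp : ∀ (γ : ℝ → (ℝ × ℝ × ℝ) × (Fin m → ℝ)) {v : (ℝ × ℝ × ℝ) × (Fin m → ℝ)} {t : ℝ}
      {w : Jet n p}, HasDerivAt γ v t → HasDerivAt (fun t => orbitMap σ (γ t)) w t →
      fderiv ℝ (orbitMap σ) (γ t) v = w := fun γ v t w hγ hw =>
    (((contDiff_orbitMap hσ).differentiable (by simp) (γ t)).hasFDerivAt.comp_hasDerivAt t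
      hγ).unique hw
  obtain ⟨⟨x, r, s⟩, c⟩ := q
  refine ⟨?_, ?_, ?_⟩
  · have h1 : HasDerivAt (fun t : ℝ => ((t, r, s), c)) ((1, 0, 0), (0 : Fin m → ℝ)) x :=
      ((hasDerivAt_id x).prodMk (hasDerivAt_const x _)).prodMk (hasDerivAt_const x c)
    have h2 : HasDerivAt (fun t => orbitMap σ ((t, r, s), c)) (1, 0) x :=
      (hasDerivAt_id x).prodMk (hasDerivAt_const x (scaleFlow r (shiftFlow s (σ c))))
    exact hcomp (fun t => ((t, r, s), c)) h1 h2
  · have h1 : HasDerivAt (fun t : ℝ => ((x, t, s), c)) ((0, 1, 0), (0 : Fin m → ℝ)) r :=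
      ((hasDerivAt_const r x).prodMk ((hasDerivAt_id r).prodMk (hasDerivAt_const r s))).prodMk
        (hasDerivAt_const r c)
    have h2 : HasDerivAt (fun t => orbitMap σ ((x, t, s), c))
        (0, scaleField (orbitMap σ ((x, r, s), c)).2) r :=
      (hasDerivAt_const r x).prodMk (hasDerivAt_scaleFlow (shiftFlow s (σ c)) r)
    exact hcomp (fun t => ((x, t, s), c)) h1 h2
  · have h1 : HasDerivAt (fun t : ℝ => ((x, r, t), c)) ((0, 0, 1), (0 : Fin m → ℝ)) s :=
      ((hasDerivAt_const s x).prodMk ((hasDerivAt_const s r).prodMk (hasDerivAt_id s))).prodMk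
        (hasDerivAt_const s c)
    have h2 : HasDerivAt (fun t => scaleFlow r (shiftFlow t (σ c)))
        (scaleFlow r (shiftField (shiftFlow s (σ c)))) s := by
      refine hasDerivAt_pi.2 fun k => hasDerivAt_pi.2 fun j => ?_
      exact (hasDerivAt_pi.1 (hasDerivAt_pi.1 (hasDerivAt_shiftFlow (σ c) s) k) j).const_mul _
    rw [scaleFlow_shiftField] at h2
    have h3 : HasDerivAt (fun t => orbitMap σ ((x, r, t), c))
        (0, Real.exp (-r) • shiftField (orbitMap σ ((x, r, s), c)).2) s :=
      (hasDerivAt_const s x).prodMk h2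
    exact hcomp (fun t => ((x, r, t), c)) h1 h3

/-- As e^{-r} ≠ 0, the orbit directions span exactly the fields that define invariance. This holds
even where these fields are dependent, so the case (3,0) is covered. -/
theorem clm_apply_fderiv_orbitMap (hσ : ContDiff ℝ ∞ σ) (L : Jet n p →L[ℝ] ℝ)
    (q : (ℝ × ℝ × ℝ) × (Fin m → ℝ)) :
    (∀ v, L (fderiv ℝ (orbitMap σ) q (v, 0)) = 0) ↔ L (1, 0) = 0 ∧
      L (0, scaleField (orbitMap σ q).2) = 0 ∧ L (0, shiftField (orbitMap σ q).2) = 0 := by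
  obtain ⟨h1, h2, h3⟩ := fderiv_orbitMap hσ q
  have e : ((0, Real.exp (-q.1.2.1) • shiftField (orbitMap σ q).2) : Jet n p)
      = Real.exp (-q.1.2.1) • (0, shiftField (orbitMap σ q).2) := by
    rw [Prod.smul_mk, smul_zero]
  rw [e] at h3
  constructor
  · intro h
    have e1 := h (1, 0, 0)
    have e2 := h (0, 1, 0)
    have e3 := h (0, 0, 1)
    rw [h1] at e1
    rw [h2] at e2
    rw [h3, map_smul, smul_eq_mul] at e3
    exact ⟨e1, e2, (mul_eq_zero.1 e3).resolve_left (Real.exp_pos _).ne'⟩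
  · rintro ⟨e1, e2, e3⟩ ⟨a, b, c⟩
    have : (((a, b, c), 0) : (ℝ × ℝ × ℝ) × (Fin m → ℝ))
        = a • ((1, 0, 0), 0) + b • ((0, 1, 0), 0) + c • ((0, 0, 1), 0) := by
      ext <;> simp
    rw [this]
    simp only [map_add, map_smul, h1, h2, h3, e1, e2, e3, smul_zero, add_zero]

/-- A cross-section of the orbits gives a fundamental system of invariants. -/
theorem isFundamentalSystem_of_section (hn : 3 ≤ n) (hσ : ContDiff ℝ ∞ σ) {U : Set (Jet n p)}
    (hU : IsOpen U) {χ : Jet n p → ℝ × ℝ × ℝ} {J : Jet n p → Fin m → ℝ} (hχ : ContinuousOn χ U)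
    (hJ : ContDiffOn ℝ ∞ J U) (hright : ∀ z ∈ U, orbitMap σ (χ z, J z) = z)
    (hmem : ∀ q, orbitMap σ q ∈ U) (hleft : ∀ q, J (orbitMap σ q) = q.2) :
    IsFundamentalSystem U fun i z => J z i := by
  have hθ := contDiff_orbitMap hσ
  -- Derivative of the identity J ∘ θ = projection, where θ is `orbitMap σ`. It yields invariance of
  -- J in the orbit directions and independence in the section directions.
  have hdJ : ∀ i q v, fderiv ℝ (fun z => J z i) (orbitMap σ q) (fderiv ℝ (orbitMap σ) q v)
      = v.2 i := by
    intro i q v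
    have h1 : DifferentiableAt ℝ (fun z => J z i) (orbitMap σ q) :=
      ((contDiffOn_pi.1 hJ i).contDiffAt (hU.mem_nhds (hmem q))).differentiableAt (by simp)
    have h2 := h1.hasFDerivAt.comp q (hθ.differentiable (by simp) q).hasFDerivAt
    have h3 : HasFDerivAt (fun q : (ℝ × ℝ × ℝ) × (Fin m → ℝ) => q.2 i)
        ((ContinuousLinearMap.proj i).comp (ContinuousLinearMap.snd ℝ (ℝ × ℝ × ℝ) (Fin m → ℝ))) q :=
      ((ContinuousLinearMap.proj (R := ℝ) (φ := fun _ : Fin m => ℝ) i).comp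
        (ContinuousLinearMap.snd ℝ (ℝ × ℝ × ℝ) (Fin m → ℝ))).hasFDerivAt
    have h4 : (fun z => J z i) ∘ orbitMap σ = fun q => q.2 i := by
      ext q; simp [hleft]
    rw [h4] at h2
    have := congrArg (fun L => L v) (h2.unique h3)
    simpa using this
  refine ⟨fun i => ?_, fun z hz => ?_, fun V hVU hV F hF z hz => ?_⟩
  · refine (isInvariantOn_iff hn).2 ⟨contDiffOn_pi.1 hJ i, fun z hz => ?_⟩
    have := (clm_apply_fderiv_orbitMap hσ (fderiv ℝ (fun z => J z i) z) (χ z, J z)).1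
    rw [hright z hz] at this
    refine this fun v => ?_
    have e := hdJ i (χ z, J z) (v, 0)
    rw [hright z hz] at e
    rw [e]; simp
  · rw [Fintype.linearIndependent_iff]
    intro g hg i
    have e := fun k => hdJ k (χ z, J z) (0, Pi.single i 1)
    rw [hright z hz] at e
    have := congrArg (fun L : Jet n p →L[ℝ] ℝ =>
      L (fderiv ℝ (orbitMap σ) (χ z, J z) (0, Pi.single i 1))) hg
    simpa [e, Pi.single_apply] using this
  · obtain ⟨hFs, hFi⟩ := (isInvariantOn_iff hn).1 hF
    have hzU := hVU hz
    -- H is F restricted to the section transported to z by fixing the orbit parameters χ z.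
    refine ⟨fun c => F (orbitMap σ (χ z, c)), ?_, ?_⟩
    · have h1 : ContDiffAt ℝ ∞ F (orbitMap σ (χ z, J z)) := by
        rw [hright z hzU]; exact hFs.contDiffAt (hV.mem_nhds hz)
      exact ContDiffAt.comp (f := fun c => orbitMap σ (χ z, c)) (J z) h1
        (hθ.contDiffAt.comp (J z) (contDiffAt_const.prodMk contDiffAt_id))
    -- As V need not be a union of orbits, constancy of F in the orbit parameters is used only on a
    -- ball whose product with a ball around J z is mapped into V. Convexity of the ball turns a
    -- zero derivative into constancy.
    · have hO : orbitMap σ ⁻¹' V ∈ 𝓝 (χ z, J z) := by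
        refine hθ.continuous.continuousAt.preimage_mem_nhds ?_
        rw [hright z hzU]; exact hV.mem_nhds hz
      obtain ⟨r, hr, hball⟩ := Metric.mem_nhds_iff.1 hO
      have hUz := hU.mem_nhds hzU
      filter_upwards [hUz, (hχ.continuousAt hUz).preimage_mem_nhds (Metric.ball_mem_nhds _ hr),
        (hJ.continuousOn.continuousAt hUz).preimage_mem_nhds (Metric.ball_mem_nhds _ hr)]
        with w hwU hwχ hwJ
      have hV' : ∀ a ∈ Metric.ball (χ z) r, orbitMap σ (a, J w) ∈ V := fun a ha => by
        refine hball ?_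
        rw [← ball_prod_same]
        exact ⟨ha, hwJ⟩
      have hder : ∀ a ∈ Metric.ball (χ z) r,
          HasFDerivAt (fun a => F (orbitMap σ (a, J w))) (0 : (ℝ × ℝ × ℝ) →L[ℝ] ℝ) a := by
        intro a ha
        have h1 : DifferentiableAt ℝ F (orbitMap σ (a, J w)) :=
          (hFs.contDiffAt (hV.mem_nhds (hV' a ha))).differentiableAt (by simp)
        have h2 : HasFDerivAt (fun a : ℝ × ℝ × ℝ => (a, J w))
            (ContinuousLinearMap.inl ℝ (ℝ × ℝ × ℝ) (Fin m → ℝ)) a :=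
          hasFDerivAt_prodMk_left a (J w)
        have h3 := h1.hasFDerivAt.comp a
          ((hθ.differentiable (by simp) (a, J w)).hasFDerivAt.comp a h2)
        refine h3.congr_fderiv ?_
        refine ContinuousLinearMap.ext fun v => ?_
        exact (clm_apply_fderiv_orbitMap hσ _ (a, J w)).2 (hFi _ (hV' a ha)) v
      have hconst := (convex_ball (χ z) r).is_const_of_fderivWithin_eq_zero (𝕜 := ℝ)
        (f := fun a => F (orbitMap σ (a, J w)))
        (fun a ha => (hder a ha).differentiableAt.differentiableWithinAt)
        (fun a ha => (hder a ha).hasFDerivWithinAt.fderivWithin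
          (Metric.isOpen_ball.uniqueDiffWithinAt ha)) hwχ (Metric.mem_ball_self hr)
      simp only [hright w hwU] at hconst
      exact hconst

end Flow

/-- Around a point with a fundamental system of `N` invariants there are no more than `N`
functionally independent invariants. -/
theorem le_of_isFundamentalSystem {n p N m : ℕ} {U V : Set (Jet n p)} {Ψ : Fin N → Jet n p → ℝ}
    (hU : IsOpen U) (hΨ : IsFundamentalSystem U Ψ) (hV : IsOpen V) {F : Fin m → Jet n p → ℝ}
    (hF : ∀ i, IsInvariantOn V (F i)) (hind : FunctIndepOn V F) {z : Jet n p} (hzU : z ∈ U)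
    (hzV : z ∈ V) : m ≤ N := by
  have hspan : ∀ i, fderiv ℝ (F i) z ∈ Submodule.span ℝ (Set.range fun k => fderiv ℝ (Ψ k) z) := by
    intro i
    obtain ⟨hs, hinv⟩ := hF i
    obtain ⟨H, hH, heq⟩ := hΨ.complete (U ∩ V) Set.inter_subset_left (hU.inter hV) (F i)
      ⟨hs.mono Set.inter_subset_right, fun W hW w hw => hinv W hW w hw.2⟩ z ⟨hzU, hzV⟩
    have h1 : HasFDerivAt (fun w k => Ψ k w)
        (ContinuousLinearMap.pi fun k => fderiv ℝ (Ψ k) z) z :=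
      hasFDerivAt_pi.2 fun k => (((hΨ.invariant k).1.contDiffAt
        (hU.mem_nhds hzU)).differentiableAt (by simp)).hasFDerivAt
    have h2 := (hH.differentiableAt (by simp)).hasFDerivAt.comp z h1
    have h3 : fderiv ℝ (F i) z = _ := (h2.congr_of_eventuallyEq heq).fderiv
    rw [h3]
    set L := fderiv ℝ H fun k => Ψ k z
    have : L.comp (ContinuousLinearMap.pi fun k => fderiv ℝ (Ψ k) z)
        = ∑ k, L (Pi.single k 1) • fderiv ℝ (Ψ k) z := by
      refine ContinuousLinearMap.ext fun v => ?_
      have e : (fun k => fderiv ℝ (Ψ k) z v)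
          = ∑ k, fderiv ℝ (Ψ k) z v • (Pi.single k 1 : Fin N → ℝ) := by
        ext k; simp [Finset.sum_apply, Pi.single_apply]
      change L (fun k => fderiv ℝ (Ψ k) z v) = _
      rw [e]
      simp [mul_comm]
    rw [this]
    exact Submodule.sum_mem _ fun k _ => Submodule.smul_mem _ _
      (Submodule.subset_span ⟨k, rfl⟩)
  classical
  have h := linearIndependent_le_span_aux' _ (hind z hzV) _ (Set.range_subset_iff.2 hspan)
  simpa using h.trans (Fintype.card_range_le _)

theorem exactNumberOfInvariants_of_local {n p N : ℕ} {Ω : Set (Jet n p)} (hΩ : IsOpen Ω)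
    (hd : Dense Ω) (h : ∀ z ∈ Ω, ∃ U : Set (Jet n p), IsOpen U ∧ z ∈ U ∧
      ∃ Ψ : Fin N → Jet n p → ℝ, IsFundamentalSystem U Ψ) : ExactNumberOfInvariants n p N := by
  refine ⟨⟨Ω, hΩ, hd, h⟩, fun V hV hne m F hF hind => ?_⟩
  obtain ⟨z, hzV, hz⟩ := hd.inter_open_nonempty V hV hne
  obtain ⟨U, hU, hzU, Ψ, hΨ⟩ := h z hz
  exact le_of_isFundamentalSystem hU hΨ hV hF hind hzU hzV

/-! ### The cross-section on the set where a_{n-3} does not vanish -/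

section Regular

variable {n p : ℕ}

/-- The index of the coefficient `a_{n-3}`. -/
def topIndex (hn : 3 ≤ n) : Fin (n - 2) := ⟨n - 3, by omega⟩

theorem shiftField_top (hn : 3 ≤ n) (b : Fin (p + 1) → Coeff n) :
    shiftField b 0 (topIndex hn) = 0 := by
  have : ¬n - 3 + 1 < n - 2 := by omega
  simp [shiftField, nextCoeff, topIndex, this]

theorem scaleFlow_top (hn : 3 ≤ n) (r : ℝ) (b : Fin (p + 1) → Coeff n) :
    scaleFlow r b 0 (topIndex hn) = Real.exp (-(3 * r)) * b 0 (topIndex hn) := by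
  simp [scaleFlow, topIndex, Nat.cast_sub hn]

theorem shiftFlow_top (hn : 3 ≤ n) (s : ℝ) (b : Fin (p + 1) → Coeff n) :
    shiftFlow s b 0 (topIndex hn) = b 0 (topIndex hn) := by
  have h : ∀ s, HasDerivAt (fun s => shiftFlow s b 0 (topIndex hn)) 0 s := fun s => by
    have := hasDerivAt_pi.1 (hasDerivAt_pi.1 (hasDerivAt_shiftFlow b s) 0) (topIndex hn)
    rwa [shiftField_top] at this
  have := is_const_of_deriv_eq_zero (fun s => (h s).differentiableAt) (fun s => (h s).deriv) s 0
  simpa [shiftFlow_zero] using this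

/-- Since a_{n-3} is constant along the flow, such a coordinate moves with constant velocity, so a
single flow time, obtained by division, brings it to 0. -/
theorem shiftFlow_of_shiftField_eq (hn : 3 ≤ n) {k : Fin (p + 1)} {j : Fin (n - 2)} {κ : ℝ}
    (hκ : ∀ b : Fin (p + 1) → Coeff n, shiftField b k j = κ * b 0 (topIndex hn))
    (s : ℝ) (b : Fin (p + 1) → Coeff n) :
    shiftFlow s b k j = b k j + s * (κ * b 0 (topIndex hn)) := by
  have h : ∀ s, HasDerivAt (fun s => shiftFlow s b k j - s * (κ * b 0 (topIndex hn))) 0 s :=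
    fun s => by
      have := hasDerivAt_pi.1 (hasDerivAt_pi.1 (hasDerivAt_shiftFlow b s) k) j
      rw [hκ, shiftFlow_top] at this
      refine (this.sub ((hasDerivAt_id s).mul_const (κ * b 0 (topIndex hn)))).congr_deriv ?_
      ring
  have := is_const_of_deriv_eq_zero (fun s => (h s).differentiableAt) (fun s => (h s).deriv) s 0
  simp only [shiftFlow_zero, zero_mul, sub_zero] at this
  linarith

/-- For n ≥ 4 the coefficient a_{n-4} is fed by its neighbour a_{n-3}, with κ = -3(n-3). For n = 3
only a_0 exists and its derivative a_0' takes this role, with κ = -6; this is where p ≥ 1 is needed.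
-/
theorem exists_shiftField_eq (hn : 3 ≤ n) (h : (n, p) ≠ (3, 0)) :
    ∃ (k : Fin (p + 1)) (j : Fin (n - 2)) (κ : ℝ), κ ≠ 0 ∧ (k, j) ≠ (0, topIndex hn) ∧
      ∀ b : Fin (p + 1) → Coeff n, shiftField b k j = κ * b 0 (topIndex hn) := by
  rcases eq_or_lt_of_le hn with rfl | hn4
  · have hp : p ≠ 0 := fun e => h (by rw [e])
    refine ⟨⟨1, by omega⟩, topIndex hn, -6, by norm_num, ?_, fun b => ?_⟩
    · simp [Fin.ext_iff]
    · simp [shiftField, nextCoeff, topIndex]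
      norm_num
  · refine ⟨0, ⟨n - 4, by omega⟩, -((n - 3 : ℝ) * 3), ?_, ?_, fun b => ?_⟩
    · have : (4 : ℝ) ≤ n := by exact_mod_cast hn4
      exact neg_ne_zero.2 (mul_ne_zero (by linarith) (by norm_num))
    · simp [Fin.ext_iff, topIndex]; omega
    · have e : (⟨n - 4 + 1, by omega⟩ : Fin (n - 2)) = topIndex hn :=
        Fin.ext (by simp only [topIndex]; omega)
      simp only [shiftField, nextCoeff, Fin.val_zero, Nat.cast_zero, zero_mul, neg_zero, zero_sub]
      rw [dif_pos (by omega), e, Nat.cast_sub (show 4 ≤ n by omega)]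
      push_cast
      ring

theorem isOpen_top_pos (hn : 3 ≤ n) (e : ℝ) :
    IsOpen {z : Jet n p | 0 < e * z.2 0 (topIndex hn)} :=
  isOpen_lt continuous_const (by fun_prop)

/-- The parameter of the scaling that normalizes `a_{n-3}` to `e = ±1`. -/
def scaleParam (hn : 3 ≤ n) (e : ℝ) (b : Fin (p + 1) → Coeff n) : ℝ :=
  -(Real.log (e * b 0 (topIndex hn)) / 3)

theorem contDiffOn_scaleParam (hn : 3 ≤ n) (e : ℝ) :
    ContDiffOn ℝ ∞ (fun z : Jet n p => scaleParam hn e z.2)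
      {z : Jet n p | 0 < e * z.2 0 (topIndex hn)} := by
  have h : ContDiffOn ℝ ∞ (fun z : Jet n p => Real.log (e * z.2 0 (topIndex hn)))
      {z : Jet n p | 0 < e * z.2 0 (topIndex hn)} :=
    ContDiffOn.log (by fun_prop) fun z hz => ne_of_gt hz
  exact (h.div_const 3).neg

theorem scaleFlow_neg_scaleParam_top (hn : 3 ≤ n) {e : ℝ} (he : e * e = 1)
    {b : Fin (p + 1) → Coeff n} (hb : 0 < e * b 0 (topIndex hn)) :
    scaleFlow (-scaleParam hn e b) b 0 (topIndex hn) = e := by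
  rw [scaleFlow_top, scaleParam,
    show -(3 * - -(Real.log (e * b 0 (topIndex hn)) / 3)) = -Real.log (e * b 0 (topIndex hn)) by
      ring, Real.exp_neg, Real.exp_log hb]
  have h1 : e ≠ 0 := fun h => by simp [h] at he
  have h2 : b 0 (topIndex hn) ≠ 0 := fun h => by simp [h] at hb
  field_simp
  linarith

theorem scaleParam_of_top_eq (hn : 3 ≤ n) {e r : ℝ} (he : e * e = 1)
    {b : Fin (p + 1) → Coeff n} (hb : b 0 (topIndex hn) = Real.exp (-(3 * r)) * e) :
    scaleParam hn e b = r := by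
  rw [scaleParam, hb, mul_left_comm, he, mul_one, Real.log_exp]
  ring

/-- Translation and scaling are already transitive on each half of the plane with coordinates x,
a_0, so the section is one fibre value e and the shift parameter can be set to 0. -/
theorem exists_fundamentalSystem_singular {e : ℝ} (he : e * e = 1) :
    ∃ Ψ : Fin 0 → Jet 3 0 → ℝ,
      IsFundamentalSystem {z : Jet 3 0 | 0 < e * z.2 0 (topIndex le_rfl)} Ψ := by
  refine ⟨_, isFundamentalSystem_of_section (σ := fun _ _ _ => e) le_rfl contDiff_const
    (isOpen_top_pos le_rfl e) (χ := fun z => (z.1, scaleParam le_rfl e z.2, 0))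
    (J := fun _ i => i.elim0) ?_ contDiffOn_const ?_ ?_ fun q => funext fun i => i.elim0⟩
  · exact continuousOn_fst.prodMk
      ((contDiffOn_scaleParam le_rfl e).continuousOn.prodMk continuousOn_const)
  · intro z hz
    have h := scaleFlow_neg_scaleParam_top le_rfl he hz
    have h' : (fun _ _ => e : Fin (0 + 1) → Coeff 3) = scaleFlow (-scaleParam le_rfl e z.2) z.2 := by
      funext k j
      rw [Subsingleton.elim (α := Fin 1) k 0, Subsingleton.elim (α := Fin 1) j (topIndex le_rfl)]
      exact h.symm
    refine Prod.ext rfl ?_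
    simp only [orbitMap]
    rw [h', shiftFlow_zero, ← scaleFlow_add, add_neg_cancel, scaleFlow_zero]
  · intro q
    simp only [Set.mem_ofPred_eq, orbitMap]
    rw [scaleFlow_top, shiftFlow_top, mul_left_comm, he]
    positivity

theorem exists_fundamentalSystem_regular (hn : 3 ≤ n) (h : (n, p) ≠ (3, 0)) {e : ℝ}
    (he : e * e = 1) : ∃ Ψ : Fin (n + p * (n - 2) - 4) → Jet n p → ℝ,
      IsFundamentalSystem {z : Jet n p | 0 < e * z.2 0 (topIndex hn)} Ψ := by
  obtain ⟨k₁, j₁, κ, hκ0, hne, hκ⟩ := exists_shiftField_eq hn h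
  set S : Finset (Fin (p + 1) × Fin (n - 2)) := {(0, topIndex hn), (k₁, j₁)}ᶜ with hS
  have hcard : S.card = n + p * (n - 2) - 4 := by
    -- Of the (p+1)(n-2) fibre coordinates, the two normalized ones are removed.
    rw [hS, Finset.card_compl, Finset.card_pair hne.symm]
    obtain ⟨m, rfl⟩ : ∃ m, n = m + 2 := ⟨n - 2, by omega⟩
    simp only [Fintype.card_prod, Fintype.card_fin, Nat.add_sub_cancel, add_mul]
    omega
  have hmemS : ∀ i, i ∈ S ↔ i ≠ (0, topIndex hn) ∧ i ≠ (k₁, j₁) := fun i => by simp [hS]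
  set E : S ≃ Fin (n + p * (n - 2) - 4) := Finset.equivFinOfCardEq hcard with hE
  -- The section: a_{n-3} = e, the coordinate (k₁, j₁) is 0, all others are free.
  set σ : (Fin (n + p * (n - 2) - 4) → ℝ) → Fin (p + 1) → Coeff n := fun c k j =>
    if h : (k, j) ∈ S then c (E ⟨(k, j), h⟩) else if (k, j) = (0, topIndex hn) then e else 0
    with hσ
  have hσs : ContDiff ℝ ∞ σ := by
    refine contDiff_pi.2 fun k => contDiff_pi.2 fun j => ?_
    simp only [hσ]
    split_ifs
    · fun_prop
    · exact contDiff_const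
    · exact contDiff_const
  have hσ0 : ∀ c, σ c 0 (topIndex hn) = e := fun c => by
    have : ((0 : Fin (p + 1)), topIndex hn) ∉ S := by simp [hmemS]
    simp only [hσ]
    rw [dif_neg this]
    exact if_pos trivial
  have hσ1 : ∀ c, σ c k₁ j₁ = 0 := fun c => by
    have : (k₁, j₁) ∉ S := by simp [hmemS]
    simp only [hσ]
    rw [dif_neg this, if_neg hne]
  have hσE : ∀ c i, σ c (E.symm i).1.1 (E.symm i).1.2 = c i := fun c i => by
    simp only [hσ]
    rw [dif_pos (show ((E.symm i).1.1, (E.symm i).1.2) ∈ S from (E.symm i).2)]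
    exact congrArg c (E.apply_symm_apply i)
  have hσeq : ∀ (d : Fin (p + 1) → Coeff n) (c : Fin (n + p * (n - 2) - 4) → ℝ),
      d 0 (topIndex hn) = e → d k₁ j₁ = 0 → (∀ i, d (E.symm i).1.1 (E.symm i).1.2 = c i) →
      σ c = d := by
    intro d c h0 h1 hc
    funext k j
    by_cases hkj : (k, j) ∈ S
    · simp only [hσ]
      rw [dif_pos hkj, ← hc, E.symm_apply_apply]
    · rw [hmemS, not_and_or, not_not, not_not, Prod.mk.injEq, Prod.mk.injEq] at hkj
      rcases hkj with ⟨rfl, rfl⟩ | ⟨rfl, rfl⟩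
      · exact (hσ0 _).trans h0.symm
      · exact (hσ1 _).trans h1.symm
  set R : Jet n p → ℝ := fun z => scaleParam hn e z.2 with hR
  -- After scaling by -R the entry a_{n-3} equals e, so the coordinate (k₁, j₁) moves with speed κe;
  -- T is the time that the shift needs to carry it from 0 to its present value.
  set T : Jet n p → ℝ := fun z => scaleFlow (-R z) z.2 k₁ j₁ / (κ * e) with hT
  set d : Jet n p → Fin (p + 1) → Coeff n := fun z => shiftFlow (-T z) (scaleFlow (-R z) z.2) with hd
  set U : Set (Jet n p) := {z | 0 < e * z.2 0 (topIndex hn)} with hU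
  have he0 : e ≠ 0 := fun h => by simp [h] at he
  have hRs : ContDiffOn ℝ ∞ R U := contDiffOn_scaleParam hn e
  have hscale : ContDiffOn ℝ ∞ (fun z => scaleFlow (-R z) z.2) U :=
    contDiff_scaleFlow.comp_contDiffOn (hRs.neg.prodMk contDiffOn_snd)
  have hTs : ContDiffOn ℝ ∞ T U :=
    (contDiffOn_pi.1 (contDiffOn_pi.1 hscale k₁) j₁).div_const _
  have hds : ContDiffOn ℝ ∞ d U := contDiff_shiftFlow.comp_contDiffOn (hTs.neg.prodMk hscale)
  refine ⟨_, isFundamentalSystem_of_section (σ := σ) hn hσs (isOpen_top_pos hn e)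
    (χ := fun z => (z.1, R z, T z)) (J := fun z i => d z (E.symm i).1.1 (E.symm i).1.2) ?_ ?_ ?_ ?_
    ?_⟩
  · exact continuousOn_fst.prodMk (hRs.continuousOn.prodMk hTs.continuousOn)
  · exact contDiffOn_pi.2 fun i => contDiffOn_pi.1 (contDiffOn_pi.1 hds _) _
  · intro z hz
    have h0 := scaleFlow_neg_scaleParam_top hn he hz
    have hd0 : d z 0 (topIndex hn) = e := by
      simp only [hd]
      rw [shiftFlow_top, h0]
    have hd1 : d z k₁ j₁ = 0 := by
      simp only [hd]
      rw [shiftFlow_of_shiftField_eq hn hκ, h0]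
      simp only [hT]
      field_simp
      ring
    refine Prod.ext rfl ?_
    simp only [orbitMap]
    rw [hσeq (d z) _ hd0 hd1 fun i => rfl]
    simp only [hd]
    rw [← shiftFlow_add, add_neg_cancel, shiftFlow_zero, ← scaleFlow_add, add_neg_cancel,
      scaleFlow_zero]
  · intro q
    simp only [Set.mem_ofPred_eq, orbitMap]
    rw [scaleFlow_top, shiftFlow_top, hσ0, mul_left_comm, he]
    positivity
  -- The parameters are recovered in the order of the composition: r from a_{n-3}, then s from the
  -- coordinate (k₁, j₁), then c.
  · rintro ⟨⟨x, r, s⟩, c⟩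
    have h1 : R (orbitMap σ ((x, r, s), c)) = r := by
      refine scaleParam_of_top_eq hn he ?_
      simp only [orbitMap]
      rw [scaleFlow_top, shiftFlow_top, hσ0]
    have h2 : scaleFlow (-R (orbitMap σ ((x, r, s), c))) (orbitMap σ ((x, r, s), c)).2
        = shiftFlow s (σ c) := by
      rw [h1]
      simp only [orbitMap]
      rw [← scaleFlow_add, neg_add_cancel, scaleFlow_zero]
    have h3 : T (orbitMap σ ((x, r, s), c)) = s := by
      simp only [hT]
      rw [h2, shiftFlow_of_shiftField_eq hn hκ, hσ1, hσ0]
      field_simp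
      ring
    funext i
    simp only [hd]
    rw [h2, h3, ← shiftFlow_add, neg_add_cancel, shiftFlow_zero, hσE]

theorem exists_fundamentalSystem (hn : 3 ≤ n) {e : ℝ} (he : e * e = 1) :
    ∃ Ψ : Fin (if (n, p) ≠ (3, 0) then n + p * (n - 2) - 4 else 0) → Jet n p → ℝ,
      IsFundamentalSystem {z : Jet n p | 0 < e * z.2 0 (topIndex hn)} Ψ := by
  by_cases h : (n, p) ≠ (3, 0)
  · rw [if_pos h]
    exact exists_fundamentalSystem_regular hn h he
  · rw [if_neg h]
    obtain ⟨rfl, rfl⟩ := Prod.mk.inj (not_not.1 h)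
    exact exists_fundamentalSystem_singular he

theorem dense_top_ne_zero (hn : 3 ≤ n) : Dense {z : Jet n p | z.2 0 (topIndex hn) ≠ 0} := by
  have h : IsOpenMap fun z : Jet n p => z.2 0 (topIndex hn) :=
    (isOpenMap_eval (topIndex hn)).comp ((isOpenMap_eval (0 : Fin (p + 1))).comp isOpenMap_snd)
  exact (dense_compl_singleton (0 : ℝ)).preimage h

end Regular

end LinODE

end

theorem theorem2 (n p : ℕ) (hn : 3 ≤ n) :
    LinODE.ExactNumberOfInvariants n p
      (if (n, p) ≠ (3, 0) then n + p * (n - 2) - 4 else 0) := by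
  refine LinODE.exactNumberOfInvariants_of_local
    (Ω := {z : LinODE.Jet n p | z.2 0 (LinODE.topIndex hn) ≠ 0})
    (isOpen_ne_fun (by fun_prop) continuous_const) (LinODE.dense_top_ne_zero hn) fun z hz => ?_
  rcases lt_or_gt_of_ne hz with h | h
  · exact ⟨_, LinODE.isOpen_top_pos hn (-1), by simpa using h,
      LinODE.exists_fundamentalSystem hn (by norm_num)⟩
  · exact ⟨_, LinODE.isOpen_top_pos hn 1, by simpa using h,
      LinODE.exists_fundamentalSystem hn (by norm_num)⟩
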